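/- Let $N\in\mathbb N$, let $E_{ij}$ be the standard basis matrices of $M_N(\mathbb C)$, let $h_1,\dots,h_N\in\mathbb R$, and let $\Gamma=(\gamma_{ijk\ell})$ be a positive semidefinite $N^2\times N^2$ matrix with rows indexed by the pairs $(i,j)$ and columns by the pairs $(k,\ell)$. Assume that $\Gamma$ is pair block diagonal: for $i\ne j$ one has $\gamma_{ijnn}=\gamma_{nnij}=0$ for all $n$, and $\gamma_{ijk\ell}=0$ whenever $k\neq\ell$ and $(k,\ell)\notin\{(i,j),(j,i)\}$. Let $$\mathcal L(\rho)=-\imath[\widetilde H,\rho]+\tfrac12\sum_{i,j,k,\ell}\gamma_{ijk\ell}\left([E_{ij},\rho E_{k\ell}^*]+[E_{ij}\rho,E_{k\ell}^*]\right),\qquad \widetilde H=\sum_n h_nE_{nn}.$$ Notation. Write $\gamma_{ij}:=\gamma_{ijij}$. For $k<\ell$ let $\mathcal L_{k\ell}$ be the compression of $\mathcal L$ to $\operatorname{Span}(E_{k\ell},E_{\ell k})$ (the $k\ell$ block of $\mathcal L$); its kernel is regarded as a subspace of $M_N(\mathbb C)$. Let $G_{\mathcal L}$ be the weighted digraph on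 $\{1,\dots,N\}$ with an edge from $j$ to $i\ne j$, of weight $\gamma_{ij}$, whenever $\gamma_{ij}>0$. A terminal strongly connected component (TSCC) is a strongly connected component from which no other component can be reached. For a TSCC $C$ let $\widetilde\rho^{\,C}_i$ be the sum, over all directed spanning trees of the subdigraph on $C$ rooted at $i$ (the underlying undirected graph is a tree on $C$, no edge is used in both directions, and $i$ is the only vertex without out-edges), of the product of the edge weights, with $\widetilde\rho^{\,C}_i=0$ for $i\notin C$, and put $\lambda_C=\sum_i\widetilde\rho^{\,C}_i$ and $d^{C}=\lambda_C^{-1}\sum_i\widetilde\rho^{\,C}_iE_{ii}$. A vertex $k$ is a sink if $\{k\}$ is a TSCC; a pair $k\ell$ with $k\neq\ell$ is a singular 2-sink if $\{k,\ell\}$ is a TSCC, $\gamma_{k\ell}=\gamma_{\ell k}$ and $\begin{pmatrix}\gamma_{k\ell k\ell}&\gamma_{k\ell\ell k}\\ \gamma_{\ell kk\ell}&\gamma_{\ell k\ell k}\end{pmatrix}$ is singular. **Theorem.** 1. $\lambda_C>0$ for every TSCC $C$ of $G_{\mathcal L}$, and $$\ker\mathcal L=\bigoplus_{k<\ell}\ker\mathcal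 L_{k\ell}\ \oplus\ \operatorname{Span}\{d^{C}: C\text{ a TSCC of }G_{\mathcal L}\}.$$ 2. For $k<\ell$, the block $\mathcal L_{k\ell}$ is singular if and only if $h_k=h_\ell$, $\gamma_{kk}=\gamma_{\ell\ell}=\gamma_{kk\ell\ell}$, and either $k$ and $\ell$ are both sinks or $k\ell$ is a singular 2-sink. If $\mathcal L_{k\ell}$ is singular, then * if $k,\ell$ are sinks, $\ker\mathcal L_{k\ell}=\operatorname{Span}(E_{k\ell},E_{\ell k})$; * if $k\ell$ is a singular 2-sink and $\gamma_{k\ell\ell k}\neq-\gamma_{k\ell}$, then $\ker\mathcal L_{k\ell}=\mathbb C\left\{(\gamma_{k\ell}+\gamma_{k\ell\ell k})E_{k\ell}+(\gamma_{k\ell}+\gamma_{\ell kk\ell})E_{\ell k}\right\}$; * if $k\ell$ is a singular 2-sink and $\gamma_{k\ell\ell k}=-\gamma_{k\ell}$, then $\ker\mathcal L_{k\ell}=\mathbb C\{E_{k\ell}-E_{\ell k}\}$. 3. Let $(T_t)_{t\ge0}$ be a quantum dynamical semigroup on $M_N(\mathbb C)$ (a continuous one-parameter semigroup of trace-preserving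 completely positive linear maps with $T_0=\mathrm{id}$) with generator $\mathcal L$. Then a state $\rho$ (positive semidefinite, of trace one) satisfies $T_t(\rho)=\rho$ for all $t\ge0$ if and only if $\rho$ belongs to the direct sum in 1. -/

import Mathlib

open scoped Topology ComplexOrder

namespace PairBlockQDS

/-! ### Quantum dynamical semigroups on `N × N` complex matrices -/

/-- `M_N(ℂ)`. -/
abbrev Mat (N : ℕ) : Type := Matrix (Fin N) (Fin N) ℂ

/-- Complete positivity: every ampliation `id ⊗ Φ` on `M_n(ℂ) ⊗ M_N(ℂ)` (block matrices whose
`(r, s)` block is mapped through `Φ`) preserves positive semidefiniteness. -/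
def IsCompletelyPositive {N : ℕ} (Φ : Mat N →ₗ[ℂ] Mat N) : Prop :=
  ∀ (n : ℕ) (X : Matrix (Fin n × Fin N) (Fin n × Fin N) ℂ), X.PosSemidef →
    (Matrix.of fun p q : Fin n × Fin N =>
      Φ (Matrix.of fun a b => X (p.1, a) (q.1, b)) p.2 q.2).PosSemidef

/-- A quantum dynamical semigroup `(T_t)_{t ≥ 0}` on `M_N(ℂ)` (Schrödinger picture). Only the values
at `t ≥ 0` matter. In finite dimension weak continuity is continuity for the usual topology. -/
structure IsQDS {N : ℕ} (T : ℝ → (Mat N →ₗ[ℂ] Mat N)) : Prop where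
  zero : T 0 = LinearMap.id
  add : ∀ t s : ℝ, 0 ≤ t → 0 ≤ s → T (t + s) = T t ∘ₗ T s
  continuousOn : ∀ A : Mat N, ContinuousOn (fun t => T t A) (Set.Ici 0)
  trace : ∀ t : ℝ, 0 ≤ t → ∀ A : Mat N, (T t A).trace = A.trace
  completelyPositive : ∀ t : ℝ, 0 ≤ t → IsCompletelyPositive (T t)

/-- `L` is the generator of `T`: `L x = lim_{t ↓ 0} (T_t x - x) / t` for all `x`. -/
def IsGenerator {N : ℕ} (T : ℝ → (Mat N →ₗ[ℂ] Mat N)) (L : Mat N →ₗ[ℂ] Mat N) : Prop :=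
  ∀ x : Mat N, Filter.Tendsto (fun t : ℝ => ((t : ℂ)⁻¹) • (T t x - x)) (𝓝[>] 0) (𝓝 (L x))

/-- States: positive semidefinite matrices of unit trace. -/
def IsState {N : ℕ} (ρ : Mat N) : Prop := ρ.PosSemidef ∧ ρ.trace = 1

/-! ### Generators written in the standard basis -/

/-- The standard basis matrix `E_{ij}`. -/
def E {N : ℕ} (i j : Fin N) : Mat N := Matrix.single i j 1

/-- Coefficient matrices `Γ = (γ_{ijkl})`, with `γ_{ijkl} = Γ (i, j) (k, l)`. -/
abbrev Coeff (N : ℕ) : Type := Matrix (Fin N × Fin N) (Fin N × Fin N) ℂ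

/-- `ρ ↦ -i[H,ρ] + ½ ∑_{ijkl} γ_{ijkl} ([E_{ij}, ρ E_{kl}^*] + [E_{ij} ρ, E_{kl}^*])`. -/
noncomputable def lindblad {N : ℕ} (H : Mat N) (Γ : Coeff N) : Mat N →ₗ[ℂ] Mat N where
  toFun ρ := -Complex.I • ⁅H, ρ⁆ + (1 / 2 : ℂ) • ∑ i, ∑ j, ∑ k, ∑ l,
    Γ (i, j) (k, l) •
      (⁅E i j, ρ * (E k l).conjTranspose⁆ + ⁅E i j * ρ, (E k l).conjTranspose⁆)
  map_add' x y := by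
    simp only [Ring.lie_def, add_mul, mul_add, smul_add, smul_sub, Finset.sum_add_distrib,
      Finset.sum_sub_distrib]
    abel
  map_smul' c x := by
    simp only [Ring.lie_def, smul_mul_assoc, mul_smul_comm, RingHom.id_apply, smul_add, smul_sub,
      Finset.smul_sum, smul_comm c]

/-- `Γ` is block diagonal for the splitting into off-diagonal and diagonal standard basis matrices,
and its off-diagonal part is pair block diagonal: the only nonzero entries of the latter are in the
`2 × 2` blocks belonging to the pairs `E_{ij}, E_{ji}`. -/
structure IsPairBlockDiagonal {N : ℕ} (Γ : Coeff N) : Prop where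
  offDiag_diag : ∀ i j n : Fin N, i ≠ j → Γ (i, j) (n, n) = 0
  diag_offDiag : ∀ i j n : Fin N, i ≠ j → Γ (n, n) (i, j) = 0
  pairBlock : ∀ i j k l : Fin N, i ≠ j → k ≠ l → (k, l) ≠ (i, j) → (k, l) ≠ (j, i) →
    Γ (i, j) (k, l) = 0

/-- The span of `E_{kl}` and `E_{lk}`. -/
def pairSpace {N : ℕ} (k l : Fin N) : Submodule ℂ (Mat N) :=
  Submodule.span ℂ {E k l, E l k}

/-- For `k ≠ l`: the coordinate projection of `M_N(ℂ)` onto the span of `E_{kl}` and `E_{lk}`. -/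
def pairProj {N : ℕ} (k l : Fin N) : Mat N →ₗ[ℂ] pairSpace k l where
  toFun x := ⟨x k l • E k l + x l k • E l k, Submodule.add_mem _
    (Submodule.smul_mem _ _ (Submodule.subset_span (by simp)))
    (Submodule.smul_mem _ _ (Submodule.subset_span (by simp)))⟩
  map_add' x y := by
    ext1
    simp only [Matrix.add_apply, add_smul, Submodule.coe_add]
    abel
  map_smul' c x := by
    ext1
    simp only [Matrix.smul_apply, smul_eq_mul, mul_smul, RingHom.id_apply, Submodule.coe_smul,
      smul_add]

/-- The `kl` block `L_{kl}` of `L`: the compression of `L` to the span of `E_{kl}`, `E_{lk}`. -/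
def block {N : ℕ} (L : Mat N →ₗ[ℂ] Mat N) (k l : Fin N) :
    pairSpace k l →ₗ[ℂ] pairSpace k l :=
  pairProj k l ∘ₗ L ∘ₗ (pairSpace k l).subtype

/-- The kernel of the `kl` block, as a subspace of `M_N(ℂ)`. -/
def blockKer {N : ℕ} (L : Mat N →ₗ[ℂ] Mat N) (k l : Fin N) : Submodule ℂ (Mat N) :=
  (LinearMap.ker (block L k l)).map (pairSpace k l).subtype

/-! ### Weighted digraphs

A weighted digraph is given by a weight function `w`, where `w i j` is the weight of the edge from
`j` to `i`; there is an edge from `j` to `i` exactly if `i ≠ j` and `w i j > 0`. Diagonal values of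
`w` play no role. -/

section Digraph

variable {V : Type} (w : V → V → ℝ)

/-- There is an edge from `i` to `j`. -/
def Edge (i j : V) : Prop := i ≠ j ∧ 0 < w j i

/-- There is a (possibly empty) directed path from `i` to `j`. -/
def Reach (i j : V) : Prop := Relation.ReflTransGen (Edge w) i j

/-- The vertex set of the strongly connected component `[i]` containing `i`. -/
def scc (i : V) : Set V := {j | Reach w i j ∧ Reach w j i}

/-- `[i] ⪯ [j]`: there is a path from some vertex of `[i]` to some vertex of `[j]`. -/
def sccLE (i j : V) : Prop := ∃ i' ∈ scc w i, ∃ j' ∈ scc w j, Reach w i' j'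

/-- `C` is (the vertex set of) a terminal strongly connected component. -/
def IsTSCC (C : Set V) : Prop := ∃ i, C = scc w i ∧ ∀ j, sccLE w i j → scc w i = scc w j

/-- A sink: a single vertex forming a terminal strongly connected component. -/
def IsSink (k : V) : Prop := IsTSCC w {k}

/-- A 2-sink: two vertices forming a terminal strongly connected component. -/
def IsTwoSink (k l : V) : Prop := k ≠ l ∧ IsTSCC w {k, l}

/-- `T` is (the edge set of) a directed spanning subtree, rooted at `i`, of the subdigraph induced
on the vertex set `C`. A pair `(a, b)` is the edge from `a` to `b`. Forgetting directions gives a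
tree on `C` (so `T` cannot contain an edge together with its reverse, which would give a double
edge), and `i` is the only vertex of `C` without out-edges in `T`. -/
structure IsRootedSpanningTree (C : Set V) (i : V) (T : Finset (V × V)) : Prop where
  edge : ∀ e ∈ T, e.1 ∈ C ∧ e.2 ∈ C ∧ Edge w e.1 e.2
  antisymm : ∀ a b : V, (a, b) ∈ T → (b, a) ∉ T
  isTree : (SimpleGraph.fromRel (fun a b : C => ((a : V), (b : V)) ∈ T)).IsTree
  root_mem : i ∈ C
  root : ∀ v ∈ C, (∀ u, (v, u) ∉ T) ↔ v = i

/-- The weight of a directed tree: the product of the weights of its edges. -/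
def treeWeight (T : Finset (V × V)) : ℝ := ∏ e ∈ T, w e.2 e.1

open Classical in
/-- The total weight of the directed spanning subtrees rooted at `i` of the subdigraph on `C`; it is
zero if `i ∉ C`. -/
noncomputable def rhoTilde [Fintype V] (C : Set V) (i : V) : ℝ :=
  ∑ T ∈ Finset.univ.filter (fun T : Finset (V × V) => IsRootedSpanningTree w C i T), treeWeight w T

/-- The normalization factor. -/
noncomputable def normFactor [Fintype V] (C : Set V) : ℝ := ∑ i, rhoTilde w C i

/-- The normalized vector of spanning tree weights. -/
noncomputable def rho [Fintype V] (C : Set V) (i : V) : ℝ := rhoTilde w C i / normFactor w C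

end Digraph

/-- The diagonal matrix `d^C = ∑_i ρ_i E_{ii}` of normalized spanning tree weights. -/
noncomputable def dMat {N : ℕ} (w : Fin N → Fin N → ℝ) (C : Set (Fin N)) : Mat N :=
  ∑ i, (rho w C i : ℂ) • E i i

/-- The weights of the digraph induced by the generator with coefficient matrix `Γ`: the edge from
`j` to `i` has weight `γ_{ij} = γ_{ijij}` (which is real and nonnegative if `Γ ≥ 0`). -/
def inducedWeight {N : ℕ} (Γ : Coeff N) (i j : Fin N) : ℝ := (Γ (i, j) (i, j)).re

/-- A singular 2-sink of the induced digraph: a 2-sink `kl` with `γ_{kl} = γ_{lk}` such that the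
`kl` block of `Γ` is singular. -/
def IsSingularTwoSink {N : ℕ} (Γ : Coeff N) (k l : Fin N) : Prop :=
  IsTwoSink (inducedWeight Γ) k l ∧ Γ (k, l) (k, l) = Γ (l, k) (l, k) ∧
    (!![Γ (k, l) (k, l), Γ (k, l) (l, k); Γ (l, k) (k, l), Γ (l, k) (l, k)] :
      Matrix (Fin 2) (Fin 2) ℂ).det = 0

/-- The summands of the kernel: the kernels of the `kl` blocks, one for each pair `k < l`, and the
span of the matrices `d^C`, where `C` runs over the terminal strongly connected components of the
induced digraph. -/
noncomputable def kerSummand {N : ℕ} (L : Mat N →ₗ[ℂ] Mat N) (Γ : Coeff N) :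
    Option {p : Fin N × Fin N // p.1 < p.2} → Submodule ℂ (Mat N)
  | some p => blockKer L p.1.1 p.1.2
  | none => Submodule.span ℂ (dMat (inducedWeight Γ) '' {C | IsTSCC (inducedWeight Γ) C})

end PairBlockQDS

open PairBlockQDS

/-! Pair block diagonality decouples the matrix entries. The diagonal of `x` evolves by the
classical rate equation of the digraph (`lindblad_diag`), and for `a ≠ b` the entry `(a, b)` is
coupled only to `(b, a)` (`lindblad_offDiag`). The kernel is therefore graded by the diagonal and
the unordered pairs of indices (`ker_lindblad`, `iSupIndep_kerSummand`).

On the diagonal one needs the stationary vectors of a weighted digraph (`stationary_eq_span`). If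
`x` is stationary then so is `|x|`, so nonvanishing propagates along edges and no mass can sit
outside the terminal components. Hence the support is a union of TSCCs, and on each of them a
stationary vector is determined by its value at one vertex. The Markov chain tree theorem
(`sum_mul_arborescenceSum`) supplies a positive solution there, once rooted spanning trees are
identified with self-maps all of whose orbits reach the root (`rhoTilde_eq_arborescenceSum`).

Off the diagonal, the block of the pair `kl` has the matrix with rows `(c, z)` and `(conj z, conj
c)`, where `c` is `decoherence h Γ k l` and `z = γ_{kllk}`. A kernel vector forces `|c| = |z|`.
Positivity of `Γ` bounds `Re γ_{kkll}` by the mean of `γ_{kk}, γ_{ll}` and `|z|` by the mean of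
`γ_{kl}, γ_{lk}`, which gives `|c| ≥ -Re c ≥ |z|`. Equality makes every estimate sharp and every
other outflow vanish (`extremal_coefficients`), and these are exactly the stated conditions. The
kernels then come from a two by two linear system.

A state is invariant exactly if the generator annihilates it: by the semigroup law the right
derivative of `T t ρ` is `T t (L ρ)` (`IsQDS.apply_eq_self`). -/

namespace PairBlockQDS

/-! ### Functional graphs and the Markov chain tree theorem -/

section FunctionalGraph

variable {V : Type*}

/-- Every orbit of `f` passes through `i`. -/
def Attracts (f : V → V) (i : V) : Prop := ∀ v, ∃ n, f^[n] v = i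

/-- The part of an orbit before its first visit to `j` never uses the value at `j`. -/
theorem Attracts.update [DecidableEq V] {f : V → V} {j : V} (hf : Attracts f j) (k : V) :
    Attracts (Function.update f j k) j := by
  intro v
  obtain ⟨n, hn⟩ := hf v
  induction n generalizing v with
  | zero => exact ⟨0, hn⟩
  | succ n ih =>
    by_cases hv : v = j
    · exact ⟨0, hv⟩
    · obtain ⟨m, hm⟩ := ih (f v) (by simpa [Function.iterate_succ_apply] using hn)
      refine ⟨m + 1, ?_⟩
      rw [Function.iterate_succ_apply, Function.update_of_ne hv, hm]

theorem Attracts.of_apply_eq {f : V → V} {i j : V} (hf : Attracts f j) (hj : f j = i) :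
    Attracts f i := by
  intro v
  obtain ⟨n, hn⟩ := hf v
  exact ⟨n + 1, by rw [Function.iterate_succ_apply', hn, hj]⟩

/-- The vertex `i` lies on a cycle because the orbit of `f i` returns to it; `j` is its predecessor
on that cycle. -/
theorem Attracts.exists_pred {f : V → V} {i : V} (hf : Attracts f i) :
    ∃ j, f j = i ∧ Attracts f j := by
  obtain ⟨n, hn⟩ := hf (f i)
  refine ⟨f^[n] i, ?_, fun v => ?_⟩
  · rw [← Function.iterate_succ_apply' f n i, Function.iterate_succ_apply, hn]
  · obtain ⟨m, hm⟩ := hf v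
    exact ⟨n + m, by rw [Function.iterate_add_apply, hm]⟩

theorem Attracts.pred_unique {f : V → V} {i j j' : V} (hj : f j = i) (hj' : f j' = i)
    (hf : Attracts f j) (hf' : Attracts f j') : j = j' := by
  by_contra hne
  obtain ⟨m, hm⟩ := hf j'
  obtain ⟨n, hn⟩ := hf' j
  obtain _ | m := m
  · exact hne hm.symm
  obtain _ | n := n
  · exact hne hn
  have h1 : f^[m + 1] j = j := by
    rw [Function.iterate_succ_apply, hj, ← hj', ← Function.iterate_succ_apply, hm]
  have h2 : f^[n + 1] j' = j' := by
    rw [Function.iterate_succ_apply, hj', ← hj, ← Function.iterate_succ_apply, hn]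
  -- Both points are periodic, with periods `m + 1` and `n + 1`. Iterating a common multiple of the
  -- periods from `j'` gives `j` as well as `j'`.
  have h3 : f^[(m + 1) * n + (m + 1)] j' = j := by
    rw [Function.iterate_add_apply, hm]
    exact Function.IsPeriodicPt.mul_const (f := f) h1 n
  have h4 : f^[(n + 1) * (m + 1)] j' = j' := Function.IsPeriodicPt.mul_const (f := f) h2 (m + 1)
  rw [show (n + 1) * (m + 1) = (m + 1) * n + (m + 1) by ring] at h4
  exact hne (h3.symm.trans h4)

open Classical in
/-- The total weight of the maps that fix `i` and attract every vertex to `i`. -/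
noncomputable def arborescenceSum [Fintype V] (w : V → V → ℝ) (i : V) : ℝ :=
  ∑ f ∈ Finset.univ.filter (fun f : V → V => f i = i ∧ Attracts f i),
    ∏ v ∈ Finset.univ.erase i, w (f v) v

-- Redirecting the root `j` from itself to `k` adds the edge from `j` to `k` with its weight, so the
-- product now runs over all vertices. Restoring the fixed point is the inverse operation.
open Classical in
theorem mul_arborescenceSum [Fintype V] (w : V → V → ℝ) (j k : V) :
    w k j * arborescenceSum w j =
      ∑ f ∈ Finset.univ.filter (fun f : V → V => f j = k ∧ Attracts f j), ∏ v, w (f v) v := by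
  rw [arborescenceSum, Finset.mul_sum]
  refine Finset.sum_nbij' (fun f => Function.update f j k) (fun f => Function.update f j j)
    ?_ ?_ ?_ ?_ ?_
  · intro f hf
    simp only [Finset.mem_filter, Finset.mem_univ, true_and] at hf ⊢
    exact ⟨Function.update_self .., hf.2.update k⟩
  · intro f hf
    simp only [Finset.mem_filter, Finset.mem_univ, true_and] at hf ⊢
    exact ⟨Function.update_self .., hf.2.update j⟩
  · intro f hf
    simp only [Finset.mem_filter, Finset.mem_univ, true_and] at hf
    rw [Function.update_idem, Function.update_eq_self_iff, hf.1]
  · intro f hf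
    simp only [Finset.mem_filter, Finset.mem_univ, true_and] at hf
    rw [Function.update_idem, Function.update_eq_self_iff, hf.1]
  · intro f _
    rw [← Finset.mul_prod_erase Finset.univ _ (Finset.mem_univ j), Function.update_self]
    congr 1
    refine Finset.prod_congr rfl fun v hv => ?_
    rw [Function.update_of_ne (Finset.ne_of_mem_erase hv)]

/-- The Markov chain tree theorem: the arborescence weights form a stationary vector. -/
theorem sum_mul_arborescenceSum [Fintype V] (w : V → V → ℝ) (i : V) :
    ∑ j, w i j * arborescenceSum w j = ∑ j, w j i * arborescenceSum w i := by
  classical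
  simp only [mul_arborescenceSum, Finset.sum_filter]
  rw [Finset.sum_comm, Finset.sum_comm (s := Finset.univ (α := V))]
  refine Finset.sum_congr rfl fun f _ => ?_
  -- Both sides count maps attracting everything to `i`, each exactly once: on the left through the
  -- unique predecessor of `i` on its cycle, on the right through the value `f i`.
  by_cases hf : Attracts f i
  · obtain ⟨j, hj, hfj⟩ := hf.exists_pred
    rw [Finset.sum_eq_single j, Finset.sum_eq_single (f i)]
    · simp [hj, hfj, hf]
    · intro k _ hk
      rw [if_neg fun h => hk h.1.symm]
    · simp
    · intro k _ hk
      rw [if_neg fun h => hk (Attracts.pred_unique h.1 hj h.2 hfj)]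
    · simp
  · rw [Finset.sum_eq_zero, Finset.sum_eq_zero]
    · intro k _
      rw [if_neg fun h => hf h.2]
    · intro k _
      rw [if_neg fun h => hf (h.2.of_apply_eq h.1)]

end FunctionalGraph

/-! ### Rooted spanning trees as functional graphs -/

section SpanningTree

theorem Attracts.mem_of_mapsTo {V : Type*} {f : V → V} {i a : V} {S : Set V} (hf : Attracts f i)
    (hS : Set.MapsTo f S S) (ha : a ∈ S) : i ∈ S := by
  obtain ⟨n, hn⟩ := hf a
  exact hn ▸ hS.iterate n ha

variable {V : Type} [Fintype V] {w : V → V → ℝ} {C : Set V}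

open Classical in
/-- The edges `(v, f v)` with `v ≠ i` of the functional graph of `f`. -/
noncomputable def functionalEdges (i : C) (f : C → C) : Finset (V × V) :=
  (Finset.univ.erase i).image fun v : C => ((v : V), (f v : V))

theorem mem_functionalEdges {i : C} {f : C → C} {e : V × V} :
    e ∈ functionalEdges i f ↔ ∃ v : C, v ≠ i ∧ ((v : V), (f v : V)) = e := by
  simp only [functionalEdges, Finset.mem_image, Finset.mem_erase, Finset.mem_univ, and_true]

theorem mk_mem_functionalEdges {i : C} {f : C → C} {a b : C} :
    ((a : V), (b : V)) ∈ functionalEdges i f ↔ a ≠ i ∧ f a = b := by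
  rw [mem_functionalEdges]
  constructor
  · rintro ⟨v, hv, h⟩
    obtain ⟨h1, h2⟩ := Prod.mk.inj h
    obtain rfl := Subtype.ext h1
    exact ⟨hv, Subtype.ext h2⟩
  · rintro ⟨ha, rfl⟩
    exact ⟨a, ha, rfl⟩

theorem injOn_functionalEdge {V : Type} {C : Set V} (f : C → C) :
    Set.InjOn (fun v : C => ((v : V), (f v : V))) Set.univ := by
  intro a _ b _ h
  exact Subtype.ext (Prod.mk.inj h).1

open Classical in
theorem card_functionalEdges (i : C) (f : C → C) :
    (functionalEdges i f).card + 1 = Fintype.card C := by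
  rw [functionalEdges, Finset.card_image_of_injOn
    ((injOn_functionalEdge f).mono (Set.subset_univ _)),
    Finset.card_erase_add_one (Finset.mem_univ i), Finset.card_univ]

open Classical in
theorem treeWeight_functionalEdges (w : V → V → ℝ) (i : C) (f : C → C) :
    treeWeight w (functionalEdges i f) = ∏ v ∈ Finset.univ.erase i, w (f v) v := by
  rw [treeWeight, functionalEdges, Finset.prod_image
    ((injOn_functionalEdge f).mono (Set.subset_univ _))]

theorem functionalEdges_injOn (i : C) :
    Set.InjOn (functionalEdges i) {f : C → C | f i = i} := by
  intro f hf g hg h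
  funext v
  by_cases hv : v = i
  · rw [hv, hf, hg]
  · have : ((v : V), (f v : V)) ∈ functionalEdges i g := by
      rw [← h, mk_mem_functionalEdges]
      exact ⟨hv, rfl⟩
    exact (mk_mem_functionalEdges.1 this).2.symm

theorem isRootedSpanningTree_functionalEdges {i : C} {f : C → C} (hf : Attracts f i)
    (he : ∀ v, v ≠ i → Edge w (v : V) (f v)) :
    IsRootedSpanningTree w C i (functionalEdges i f) where
  edge := by
    rintro e hfe
    obtain ⟨v, hv, rfl⟩ := mem_functionalEdges.1 hfe
    exact ⟨v.2, (f v).2, he v hv⟩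
  antisymm := by
    intro a b hab hba
    obtain ⟨v, hv, h1⟩ := mem_functionalEdges.1 hab
    obtain ⟨u, hu, h2⟩ := mem_functionalEdges.1 hba
    simp only [Prod.mk.injEq] at h1 h2
    have h3 : f v = u := Subtype.ext (h1.2.trans h2.1.symm)
    have h4 : f u = v := Subtype.ext (h2.2.trans h1.1.symm)
    -- A two-cycle avoiding the root would be an invariant set whose orbits never reach the root.
    have : i ∈ ({v, u} : Set C) := hf.mem_of_mapsTo (a := v) (by
      rintro x (rfl | rfl)
      · simp [h3]
      · simp [h4]) (by simp)
    rcases this with h | h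
    · exact hv h.symm
    · exact hu h.symm
  isTree := by
    classical
    set G := SimpleGraph.fromRel fun a b : C => ((a : V), (b : V)) ∈ functionalEdges i f with hG
    have hconn : G.Connected := by
      rw [SimpleGraph.connected_iff_exists_forall_reachable]
      refine ⟨i, fun v => ?_⟩
      obtain ⟨n, hn⟩ := hf v
      induction n generalizing v with
      | zero => rw [show v = i from hn]
      | succ n ih =>
        by_cases hv : v = i
        · rw [hv]
        · refine (ih (f v) hn).trans (SimpleGraph.Adj.reachable ?_)
          rw [hG, SimpleGraph.fromRel_adj]
          exact ⟨fun h => (he v hv).1 (congrArg Subtype.val h.symm),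
            Or.inr (mk_mem_functionalEdges.2 ⟨hv, rfl⟩)⟩
    -- A connected graph has at least `|C| - 1` edges, and here every edge comes from one of the
    -- `|C| - 1` vertices other than the root.
    rw [SimpleGraph.isTree_iff_connected_and_card]
    refine ⟨hconn, le_antisymm ?_ hconn.card_vert_le_card_edgeSet_add_one⟩
    have hsub : G.edgeFinset ⊆ (Finset.univ.erase i).image fun v => s(v, f v) := by
      intro e
      induction e with | _ a b => ?_
      rw [SimpleGraph.mem_edgeFinset, SimpleGraph.mem_edgeSet, hG, SimpleGraph.fromRel_adj,
        mk_mem_functionalEdges, mk_mem_functionalEdges, Finset.mem_image]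
      rintro ⟨-, h | h⟩
      · exact ⟨a, by simp [h.1], by rw [h.2]⟩
      · exact ⟨b, by simp [h.1], by rw [h.2, Sym2.eq_swap]⟩
    rw [Nat.card_eq_fintype_card, Nat.card_eq_fintype_card, ← SimpleGraph.edgeFinset_card]
    calc G.edgeFinset.card + 1 ≤ (Finset.univ.erase i).card + 1 :=
          Nat.add_le_add_right ((Finset.card_le_card hsub).trans Finset.card_image_le) 1
      _ = Fintype.card C := by
          rw [Finset.card_erase_add_one (Finset.mem_univ i), Finset.card_univ]
  root_mem := i.2
  root := by
    intro v hv
    constructor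
    · intro h
      by_contra hne
      exact h _ (mk_mem_functionalEdges (a := ⟨v, hv⟩).2
        ⟨fun h' => hne (congrArg Subtype.val h'), rfl⟩)
    · rintro rfl u hu
      obtain ⟨x, hx, h⟩ := mem_functionalEdges.1 hu
      exact hx (Subtype.ext (Prod.mk.inj h).1)

/-- Choosing one out-edge at each vertex other than the root already gives `|C| - 1` edges, as many
as a tree has, so the chosen edges exhaust `T`. -/
theorem IsRootedSpanningTree.exists_functionalEdges {i : C} {T : Finset (V × V)}
    (hT : IsRootedSpanningTree w C i T) :
    ∃ f : C → C, f i = i ∧ Attracts f i ∧ (∀ v, v ≠ i → Edge w (v : V) (f v)) ∧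
      functionalEdges i f = T := by
  classical
  have hout : ∀ v : C, ∃ u : C, (v = i → u = i) ∧ (v ≠ i → ((v : V), (u : V)) ∈ T) := by
    intro v
    by_cases hv : v = i
    · exact ⟨i, fun _ => rfl, fun h => absurd hv h⟩
    · have := mt (hT.root v v.2).1 fun h => hv (Subtype.ext h)
      push Not at this
      obtain ⟨u, hu⟩ := this
      exact ⟨⟨u, (hT.edge _ hu).2.1⟩, fun h => absurd h hv, fun _ => hu⟩
  choose f hfi hfT using hout
  set G := SimpleGraph.fromRel fun a b : C => ((a : V), (b : V)) ∈ T with hG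
  have hsub : functionalEdges i f ⊆ T := by
    intro e he
    obtain ⟨v, hv, rfl⟩ := mem_functionalEdges.1 he
    exact hfT v hv
  have hcardT : T.card ≤ G.edgeFinset.card := by
    -- Forgetting directions loses no edges because `T` contains no edge together with its reverse.
    have hinj : Set.InjOn (fun e : V × V => s(e.1, e.2)) T := by
      rintro ⟨a, b⟩ hab ⟨c, d⟩ hcd h
      rcases Sym2.eq_iff.1 h with ⟨h1, h2⟩ | ⟨h1, h2⟩
      · exact Prod.ext h1 h2
      · simp only at h1 h2
        subst h1 h2
        exact absurd hcd (hT.antisymm _ _ hab)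
    rw [← Finset.card_image_of_injOn hinj]
    refine (Finset.card_le_card (t := G.edgeFinset.image (Sym2.map Subtype.val)) ?_).trans
      Finset.card_image_le
    intro e he
    obtain ⟨⟨a, b⟩, hab, rfl⟩ := Finset.mem_image.1 he
    obtain ⟨ha, hb, hE⟩ := hT.edge _ hab
    refine Finset.mem_image.2 ⟨s(⟨a, ha⟩, ⟨b, hb⟩), ?_, rfl⟩
    rw [SimpleGraph.mem_edgeFinset, SimpleGraph.mem_edgeSet, hG, SimpleGraph.fromRel_adj]
    exact ⟨fun h => hE.1 (congrArg Subtype.val h), Or.inl hab⟩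
  have hTree : G.IsTree := hT.isTree
  have heq : functionalEdges i f = T := by
    refine Finset.eq_of_subset_of_card_le hsub ?_
    have h1 := card_functionalEdges i f
    have h2 := hTree.card_edgeFinset
    omega
  refine ⟨f, hfi i rfl, ?_, fun v hv => (hT.edge _ (hfT v hv)).2.2, heq⟩
  -- Having an orbit that reaches the root passes across each tree edge in either direction, hence
  -- along walks starting at the root.
  have hadj : ∀ a b, G.Adj a b → (∃ n, f^[n] a = i) → ∃ n, f^[n] b = i := by
    rintro a b hab ⟨n, hn⟩
    rw [hG, SimpleGraph.fromRel_adj, ← heq, mk_mem_functionalEdges, mk_mem_functionalEdges] at hab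
    rcases hab with ⟨-, ⟨ha, rfl⟩ | ⟨hb, rfl⟩⟩
    · obtain _ | n := n
      · exact absurd hn ha
      · exact ⟨n, hn⟩
    · exact ⟨n + 1, hn⟩
  intro v
  obtain ⟨p⟩ := hTree.connected.preconnected i v
  have : ∀ a b, G.Walk a b → (∃ n, f^[n] a = i) → ∃ n, f^[n] b = i := by
    intro a b p
    induction p with
    | nil => exact id
    | cons h _ ih => exact fun ha => ih (hadj _ _ h ha)
  exact this i v p ⟨0, rfl⟩

theorem rhoTilde_eq_zero {i : V} (hi : i ∉ C) : rhoTilde w C i = 0 := by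
  classical
  rw [rhoTilde, Finset.sum_filter]
  exact Finset.sum_eq_zero fun T _ => if_neg fun h => hi h.root_mem

-- Rooted spanning trees correspond to attracting maps that follow edges; the other attracting maps
-- in `arborescenceSum` have weight zero.
open Classical in
theorem rhoTilde_eq_arborescenceSum (hw : ∀ i j, i ≠ j → 0 ≤ w i j) (i : C) :
    rhoTilde w C i = arborescenceSum (fun a b : C => w a b) i := by
  classical
  rw [arborescenceSum, ← Finset.sum_subset (s₁ := Finset.univ.filter fun f : C → C =>
    f i = i ∧ Attracts f i ∧ ∀ v, v ≠ i → Edge w (v : V) (f v)), rhoTilde]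
  · symm
    refine Finset.sum_nbij (functionalEdges i) ?_ ?_ ?_ ?_
    · intro f hf
      simp only [Finset.mem_filter, Finset.mem_univ, true_and] at hf ⊢
      exact isRootedSpanningTree_functionalEdges hf.2.1 hf.2.2
    · refine (functionalEdges_injOn i).mono fun f hf => ?_
      simp only [Finset.coe_filter, Finset.mem_univ, true_and, Set.mem_ofPred_eq] at hf
      exact hf.1
    · intro T hT
      simp only [Finset.coe_filter, Finset.mem_univ, true_and, Set.mem_ofPred_eq] at hT
      obtain ⟨f, h1, h2, h3, h4⟩ := hT.exists_functionalEdges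
      exact ⟨f, by simpa using ⟨h1, h2, fun a ha h => h3 ⟨a, ha⟩ h⟩, h4⟩
    · intro f _
      rw [treeWeight_functionalEdges]
      congr!
  · intro f hf
    simp only [Finset.mem_filter, Finset.mem_univ, true_and] at hf ⊢
    exact ⟨hf.1, hf.2.1⟩
  · intro f hf hf'
    simp only [Finset.mem_filter, Finset.mem_univ, true_and] at hf hf'
    have : ∃ v, v ≠ i ∧ ¬ Edge w (v : V) (f v) := by
      by_contra! h
      exact hf' ⟨hf.1, hf.2, h⟩
    obtain ⟨v, hv, hE⟩ := this
    -- A fixed point other than the root would never reach the root. So the failure to be an edge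
    -- comes from a vanishing weight.
    have hne : (v : V) ≠ f v := by
      intro h
      have : i ∈ ({v} : Set C) := hf.2.mem_of_mapsTo (a := v) (by
        rintro x rfl
        exact (Subtype.ext h).symm) rfl
      exact hv this.symm
    refine Finset.prod_eq_zero (i := v) (by simpa using hv) ?_
    exact le_antisymm (not_lt.1 fun h => hE ⟨hne, h⟩) (hw _ _ hne.symm)

theorem treeWeight_pos {V : Type} {w : V → V → ℝ} {C : Set V} {i : V} {T : Finset (V × V)} (hT : IsRootedSpanningTree w C i T) :
    0 < treeWeight w T :=
  Finset.prod_pos fun e he => (hT.edge e he).2.2.2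

theorem rhoTilde_nonneg (C : Set V) (i : V) : 0 ≤ rhoTilde w C i := by
  classical
  refine Finset.sum_nonneg fun T hT => (treeWeight_pos (Finset.mem_filter.1 hT).2).le

/-- A strongly connected component has a spanning tree rooted at each of its vertices. -/
theorem exists_isRootedSpanningTree {k : V} (i : scc w k) :
    ∃ T, IsRootedSpanningTree w (scc w k) i T := by
  classical
  have hlen : ∀ v, Reach w v i → ∃ n : ℕ, ∃ p : ℕ → V, p 0 = v ∧ p n = i ∧
      ∀ m < n, Edge w (p m) (p (m + 1)) := by
    intro v hv
    induction hv using Relation.ReflTransGen.head_induction_on with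
    | refl => exact ⟨0, fun _ => i, rfl, rfl, by simp⟩
    | @head a c hac _ ih =>
      obtain ⟨n, p, h0, hn, hp⟩ := ih
      refine ⟨n + 1, fun m => Nat.casesOn m a p, rfl, hn, ?_⟩
      rintro (_ | m) hm
      · simpa [h0] using hac
      · exact hp m (by omega)
  have hreach : ∀ v : scc w k, Reach w (v : V) i := fun v => v.2.2.trans i.2.1
  have hex : ∀ v : scc w k, ∃ n : ℕ, ∃ p : ℕ → V, p 0 = v ∧ p n = i ∧
      ∀ m < n, Edge w (p m) (p (m + 1)) := fun v => hlen v (hreach v)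
  -- The distance to the root. The map `f` will follow the first step of a shortest path, so `d`
  -- decreases strictly and all orbits reach the root.
  let d : scc w k → ℕ := fun v => Nat.find (hex v)
  have hstep : ∀ v : scc w k, v ≠ i → ∃ u : scc w k, Edge w (v : V) u ∧ d u < d v := by
    intro v hv
    obtain ⟨p, h0, hn, hp⟩ := Nat.find_spec (hex v)
    change p (d v) = i at hn
    change ∀ m < d v, _ at hp
    obtain ⟨m, hm⟩ : ∃ m, d v = m + 1 := by
      refine Nat.exists_eq_succ_of_ne_zero fun h => hv (Subtype.ext ?_)
      rw [← h0, ← hn, h]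
    rw [hm] at hn hp
    have hE : Edge w (v : V) (p 1) := h0 ▸ hp 0 (by omega)
    have htail : ∀ j ≤ m, Reach w (p (m + 1 - j)) i := by
      intro j
      induction j with
      | zero => intro _; rw [Nat.sub_zero, hn]; exact Relation.ReflTransGen.refl
      | succ j ih =>
        intro hj
        refine Relation.ReflTransGen.head ?_ (ih (by omega))
        have := hp (m + 1 - (j + 1)) (by omega)
        rwa [show m + 1 - (j + 1) + 1 = m + 1 - j by omega] at this
    have h1 : Reach w (p 1) i := by
      have := htail m le_rfl
      rwa [show m + 1 - m = 1 by omega] at this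
    refine ⟨⟨p 1, v.2.1.tail hE, h1.trans i.2.2⟩, hE, ?_⟩
    rw [hm, Nat.lt_succ_iff]
    refine Nat.find_le ⟨fun j => p (j + 1), rfl, hn, fun j hj => hp (j + 1) (by omega)⟩
  have hf : ∀ v : scc w k, ∃ u : scc w k, v ≠ i → Edge w (v : V) u ∧ d u < d v := by
    intro v
    by_cases hv : v = i
    · exact ⟨i, fun h => absurd hv h⟩
    · obtain ⟨u, hu⟩ := hstep v hv
      exact ⟨u, fun _ => hu⟩
  choose f hf using hf
  refine ⟨_, isRootedSpanningTree_functionalEdges (f := f) (i := i) ?_ fun v hv => (hf v hv).1⟩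
  intro v
  induction hd : d v using Nat.strong_induction_on generalizing v with
  | _ n ih =>
    by_cases hv : v = i
    · exact ⟨0, hv⟩
    · obtain ⟨m, hm⟩ := ih _ (hd ▸ (hf v hv).2) (f v) rfl
      exact ⟨m + 1, hm⟩

theorem rhoTilde_pos {C : Set V} (hC : IsTSCC w C) {i : V} (hi : i ∈ C) : 0 < rhoTilde w C i := by
  classical
  obtain ⟨k, rfl, -⟩ := hC
  obtain ⟨T, hT⟩ := exists_isRootedSpanningTree ⟨i, hi⟩
  refine Finset.sum_pos (fun S hS => treeWeight_pos (Finset.mem_filter.1 hS).2) ⟨T, ?_⟩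
  simpa using hT

theorem normFactor_pos {C : Set V} (hC : IsTSCC w C) : 0 < normFactor w C := by
  obtain ⟨k, hk, -⟩ := id hC
  have hkC : k ∈ C := hk ▸ ⟨Relation.ReflTransGen.refl, Relation.ReflTransGen.refl⟩
  exact Finset.sum_pos' (fun i _ => rhoTilde_nonneg C i) ⟨k, Finset.mem_univ k, rhoTilde_pos hC hkC⟩

end SpanningTree

/-! ### Stationary vectors of weighted digraphs -/

section Stationary

variable {V : Type} {w : V → V → ℝ}

theorem mem_scc_self (k : V) : k ∈ scc w k :=
  ⟨Relation.ReflTransGen.refl, Relation.ReflTransGen.refl⟩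

theorem scc_eq_of_mem {k i : V} (hi : i ∈ scc w k) : scc w i = scc w k := by
  ext j
  exact ⟨fun h => ⟨hi.1.trans h.1, h.2.trans hi.2⟩, fun h => ⟨hi.2.trans h.1, h.2.trans hi.1⟩⟩

theorem IsTSCC.eq_scc {C : Set V} (hC : IsTSCC w C) {i : V} (hi : i ∈ C) : C = scc w i := by
  obtain ⟨k, rfl, -⟩ := hC
  exact (scc_eq_of_mem hi).symm

theorem IsTSCC.nonempty {C : Set V} (hC : IsTSCC w C) : C.Nonempty := by
  obtain ⟨k, rfl, -⟩ := hC
  exact ⟨k, mem_scc_self k⟩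

theorem IsTSCC.mem_of_reach {C : Set V} (hC : IsTSCC w C) {i j : V} (hi : i ∈ C)
    (hij : Reach w i j) : j ∈ C := by
  obtain ⟨k, rfl, hk⟩ := hC
  rw [hk j ⟨i, hi, j, mem_scc_self j, hij⟩]
  exact mem_scc_self j

theorem IsTSCC.weight_eq_zero (hw : ∀ i j, 0 ≤ w i j) {C : Set V} (hC : IsTSCC w C) {i j : V}
    (hi : i ∈ C) (hj : j ∉ C) : w j i = 0 := by
  refine le_antisymm (not_lt.1 fun h => hj (hC.mem_of_reach hi (Relation.ReflTransGen.single
    ⟨fun hij => hj (hij ▸ hi), h⟩))) (hw j i)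

/-- A strongly connected component is terminal if everything it reaches can be reached from. -/
theorem isTSCC_scc {v : V} (h : ∀ j, Reach w v j → Reach w j v) : IsTSCC w (scc w v) := by
  refine ⟨v, rfl, ?_⟩
  rintro j ⟨i', hi', j', hj', hij⟩
  have hvj : Reach w v j := (hi'.1.trans hij).trans hj'.2
  exact (scc_eq_of_mem ⟨hvj, h j hvj⟩).symm

variable [Fintype V]

variable (w) in
/-- The vectors for which the inflow into each vertex balances the outflow. -/
def stationary : Submodule ℂ (V → ℂ) where
  carrier := {x | ∀ i, ∑ j, (w i j : ℂ) * x j = ∑ j, (w j i : ℂ) * x i}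
  zero_mem' := by simp
  add_mem' := by
    intro x y hx hy i
    simp only [Pi.add_apply, mul_add, Finset.sum_add_distrib, hx i, hy i]
  smul_mem' := by
    intro c x hx i
    have := congrArg (c * ·) (hx i)
    simp only [Finset.mul_sum] at this
    simpa only [Pi.smul_apply, smul_eq_mul, mul_left_comm c] using this

theorem mem_stationary {x : V → ℂ} :
    x ∈ stationary w ↔ ∀ i, ∑ j, (w i j : ℂ) * x j = ∑ j, (w j i : ℂ) * x i := Iff.rfl

/-- The triangle inequality makes the outflow of `|x|` at most its inflow at each vertex. Summed
over all vertices the two agree, so equality holds everywhere. -/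
theorem norm_mem_stationary (hw : ∀ i j, 0 ≤ w i j) {x : V → ℂ} (hx : x ∈ stationary w) (i : V) :
    ∑ j, w i j * ‖x j‖ = ∑ j, w j i * ‖x i‖ := by
  have hle : ∀ i ∈ Finset.univ, ∑ j, w j i * ‖x i‖ ≤ ∑ j, w i j * ‖x j‖ := by
    intro i _
    calc ∑ j, w j i * ‖x i‖ = ‖∑ j, (w j i : ℂ) * x i‖ := by
          rw [← Finset.sum_mul, ← Finset.sum_mul, norm_mul, ← Complex.ofReal_sum,
            Complex.norm_of_nonneg (Finset.sum_nonneg fun j _ => hw j i)]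
      _ = ‖∑ j, (w i j : ℂ) * x j‖ := by rw [hx i]
      _ ≤ ∑ j, ‖(w i j : ℂ) * x j‖ := norm_sum_le _ _
      _ = ∑ j, w i j * ‖x j‖ := by
          refine Finset.sum_congr rfl fun j _ => ?_
          rw [norm_mul, Complex.norm_of_nonneg (hw i j)]
  exact ((Finset.sum_eq_sum_iff_of_le hle).1 Finset.sum_comm i (Finset.mem_univ i)).symm

/-- If `x` vanishes at a vertex, the outflow of `|x|` there is zero, hence so is each nonnegative
term of its inflow. -/
theorem ne_zero_of_reach (hw : ∀ i j, 0 ≤ w i j) {x : V → ℂ} (hx : x ∈ stationary w) {a b : V}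
    (hab : Reach w a b) (ha : x a ≠ 0) : x b ≠ 0 := by
  induction hab with
  | refl => exact ha
  | @tail b c _ hbc ih =>
    intro hc
    have h := norm_mem_stationary hw hx c
    rw [hc, norm_zero] at h
    simp only [mul_zero, Finset.sum_const_zero] at h
    have h0 := (Finset.sum_eq_zero_iff_of_nonneg fun j _ =>
      mul_nonneg (hw c j) (norm_nonneg (x j))).1 h b (Finset.mem_univ b)
    exact (mul_pos hbc.2 (norm_pos_iff.2 ih)).ne' h0

/-- No mass flows into a set of vertices without outgoing edges. -/
theorem eq_zero_of_edge_into_closed (hw : ∀ i j, 0 ≤ w i j) {x : V → ℂ} (hx : x ∈ stationary w)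
    {S : Set V} (hS : ∀ i ∈ S, ∀ j, Edge w i j → j ∈ S) {a b : V} (ha : a ∉ S) (hb : b ∈ S)
    (hab : Edge w a b) : x a = 0 := by
  classical
  have hout : ∀ i ∈ S, ∀ j, j ∉ S → w j i = 0 := fun i hi j hj =>
    le_antisymm (not_lt.1 fun h => hj (hS i hi j ⟨fun hij => hj (hij ▸ hi), h⟩)) (hw j i)
  let F : Finset V := Finset.univ.filter (· ∈ S)
  have hF : ∀ i, i ∈ F ↔ i ∈ S := by simp [F]
  have h1 : ∑ i ∈ F, ∑ j, w i j * ‖x j‖ = ∑ i ∈ F, ∑ j, w j i * ‖x i‖ :=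
    Finset.sum_congr rfl fun i _ => norm_mem_stationary hw hx i
  -- Nothing leaves `S`, so its total outflow stays inside. Balance then forces the inflow from the
  -- complement to be zero.
  have h2 : ∑ i ∈ F, ∑ j, w j i * ‖x i‖ = ∑ i ∈ F, ∑ j ∈ F, w i j * ‖x j‖ := by
    rw [Finset.sum_comm (s := F) (t := F)]
    refine Finset.sum_congr rfl fun i hi => ?_
    symm
    refine Finset.sum_subset (Finset.subset_univ F) fun j _ hj => ?_
    rw [hout i ((hF i).1 hi) j (fun h => hj ((hF j).2 h)), zero_mul]
  have h3 : ∑ i ∈ F, ∑ j ∈ Fᶜ, w i j * ‖x j‖ = 0 := by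
    have h4 : ∀ i, ∑ j, w i j * ‖x j‖ =
        ∑ j ∈ F, w i j * ‖x j‖ + ∑ j ∈ Fᶜ, w i j * ‖x j‖ := fun i =>
      (Finset.sum_add_sum_compl F _).symm
    rw [Finset.sum_congr rfl fun i _ => h4 i, Finset.sum_add_distrib, h2] at h1
    linarith
  have hnn : ∀ i j, 0 ≤ w i j * ‖x j‖ := fun i j => mul_nonneg (hw i j) (norm_nonneg _)
  have h5 := (Finset.sum_eq_zero_iff_of_nonneg fun i _ =>
    Finset.sum_nonneg fun j _ => hnn i j).1 h3 b ((hF b).2 hb)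
  have h6 := (Finset.sum_eq_zero_iff_of_nonneg fun j _ => hnn b j).1 h5 a
    (by rw [Finset.mem_compl, hF]; exact ha)
  exact norm_eq_zero.1 ((mul_eq_zero.1 h6).resolve_left hab.2.ne')

theorem isTSCC_of_ne_zero (hw : ∀ i j, 0 ≤ w i j) {x : V → ℂ} (hx : x ∈ stationary w) {v : V}
    (hv : x v ≠ 0) : IsTSCC w (scc w v) := by
  refine isTSCC_scc fun j hvj => ?_
  induction hvj using Relation.ReflTransGen.head_induction_on with
  | refl => exact Relation.ReflTransGen.refl
  | @head a c hac _ ih =>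
    by_contra hja
    have hc := ih (ne_zero_of_reach hw hx (Relation.ReflTransGen.single hac) hv)
    -- The set of vertices reachable from `j` is closed under edges; it contains `c` but not `a`, so
    -- the edge from `a` to `c` forces `x a = 0`.
    exact hv (eq_zero_of_edge_into_closed hw hx (S := {u | Reach w j u})
      (fun i hi k hik => Relation.ReflTransGen.tail hi hik) hja hc hac)

/-- No edge leaves `C`, so at vertices of `C` the balance equation involves `C` alone and is the
Markov chain tree theorem there. At other vertices both sides vanish. -/
theorem rho_mem_stationary (hw : ∀ i j, 0 ≤ w i j) {C : Set V} (hC : IsTSCC w C) :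
    (fun i => (rho w C i : ℂ)) ∈ stationary w := by
  classical
  have hoff : ∀ i, i ∉ C → rhoTilde w C i = 0 := fun i hi => rhoTilde_eq_zero hi
  have hsum : ∀ g : V → ℝ, (∀ j, j ∉ C → g j = 0) → ∑ j, g j = ∑ j : C, g j := by
    intro g hg
    rw [← Finset.sum_subset (Finset.subset_univ (C.toFinset)) fun j _ hj => hg j (by simpa using hj)]
    exact Finset.sum_subtype _ (by simp) _
  have key : ∀ i, ∑ j, w i j * rhoTilde w C j = ∑ j, w j i * rhoTilde w C i := by
    intro i
    by_cases hi : i ∈ C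
    · rw [hsum _ fun j hj => by rw [hoff j hj, mul_zero],
        hsum _ fun j hj => by rw [hC.weight_eq_zero hw hi hj, zero_mul]]
      have := sum_mul_arborescenceSum (fun a b : C => w a b) ⟨i, hi⟩
      simpa only [← rhoTilde_eq_arborescenceSum fun i j _ => hw i j] using this
    · rw [hoff i hi]
      simp only [mul_zero, Finset.sum_const_zero]
      refine Finset.sum_eq_zero fun j _ => ?_
      by_cases hj : j ∈ C
      · rw [hC.weight_eq_zero hw hj hi, zero_mul]
      · rw [hoff j hj, mul_zero]
  intro i
  have := congrArg (· / normFactor w C) (key i)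
  simp only [Finset.sum_div, mul_div_assoc] at this
  simp only [rho]
  exact_mod_cast this

theorem stationary_eq_span (hw : ∀ i j, 0 ≤ w i j) :
    stationary w =
      Submodule.span ℂ ((fun C i => (rho w C i : ℂ)) '' {C : Set V | IsTSCC w C}) := by
  classical
  apply le_antisymm
  · intro x hx
    have hrep : ∀ C : Set V, IsTSCC w C → ∃ i, i ∈ C := fun C hC => hC.nonempty
    rcases isEmpty_or_nonempty V with hV | hV
    · rw [Subsingleton.elim x 0]
      exact zero_mem _
    choose! r hr using hrep
    let F : Finset (Set V) := Finset.univ.filter (IsTSCC w)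
    have hF : ∀ C, C ∈ F ↔ IsTSCC w C := by simp [F]
    -- The coefficients make `y` agree with `x` at one representative of each TSCC, since distinct
    -- components are disjoint. A nonzero value of `x - y` would lie in some TSCC and propagate to
    -- its representative.
    let y : V → ℂ := ∑ C ∈ F, (x (r C) / (rho w C (r C) : ℂ)) • fun i => (rho w C i : ℂ)
    have hyspan : y ∈ Submodule.span ℂ ((fun C i => (rho w C i : ℂ)) '' {C | IsTSCC w C}) :=
      Submodule.sum_mem _ fun C hC => Submodule.smul_mem _ _
        (Submodule.subset_span ⟨C, (hF C).1 hC, rfl⟩)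
    have hy : y ∈ stationary w :=
      Submodule.sum_mem _ fun C hC => Submodule.smul_mem _ _ (rho_mem_stationary hw ((hF C).1 hC))
    have hz : x - y ∈ stationary w := Submodule.sub_mem _ hx hy
    have hzr : ∀ C, IsTSCC w C → (x - y) (r C) = 0 := by
      intro C hC
      have hpos : rho w C (r C) ≠ 0 :=
        (div_pos (rhoTilde_pos hC (hr C hC)) (normFactor_pos hC)).ne'
      have : y (r C) = x (r C) := by
        simp only [y, Finset.sum_apply, Pi.smul_apply, smul_eq_mul]
        rw [Finset.sum_eq_single C]
        · exact div_mul_cancel₀ _ (by exact_mod_cast hpos)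
        · intro D hD hDC
          have hrD : r C ∉ D := fun h =>
            hDC ((((hF D).1 hD).eq_scc h).trans (hC.eq_scc (hr C hC)).symm)
          rw [show rho w D (r C) = 0 by rw [rho, rhoTilde_eq_zero hrD, zero_div],
            Complex.ofReal_zero, mul_zero]
        · exact fun h => absurd ((hF C).2 hC) h
      rw [Pi.sub_apply, this, sub_self]
    have hzero : x - y = 0 := by
      funext v
      by_contra hv
      have hT := isTSCC_of_ne_zero hw hz hv
      exact ne_zero_of_reach hw hz (hr _ hT).1 hv (hzr _ hT)
    rw [sub_eq_zero.1 hzero]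
    exact hyspan
  · rw [Submodule.span_le]
    rintro _ ⟨C, hC, rfl⟩
    exact rho_mem_stationary hw hC

end Stationary

/-! ### Matrix entries of the generator -/

section Entries

variable {N : ℕ}

theorem dissipator_apply (x : Mat N) (i j k l a b : Fin N) :
    (⁅E i j, x * (E k l).conjTranspose⁆ + ⁅E i j * x, (E k l).conjTranspose⁆) a b =
      2 * (if i = a then if k = b then x j l else 0 else 0) -
        (if l = a then if k = i then x j b else 0 else 0) -
        (if j = b then if k = i then x a l else 0 else 0) := by
  have h1 : (E i j * (x * E l k)) a b = if i = a then if k = b then x j l else 0 else 0 := by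
    by_cases hi : i = a
    · subst hi
      by_cases hk : k = b
      · subst hk; simp [E]
      · simp [E, hk, Ne.symm hk]
    · simp [E, hi, Ne.symm hi]
  have h2 : (E l k * (E i j * x)) a b = if l = a then if k = i then x j b else 0 else 0 := by
    by_cases hl : l = a
    · subst hl
      by_cases hk : k = i
      · subst hk; simp [E]
      · rw [← Matrix.mul_assoc]; simp [E, hk]
    · simp [E, hl, Ne.symm hl]
  have h3 : (x * E l k * E i j) a b = if j = b then if k = i then x a l else 0 else 0 := by
    by_cases hj : j = b
    · subst hj
      by_cases hk : k = i
      · subst hk; simp [E]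
      · rw [Matrix.mul_assoc]; simp [E, hk]
    · simp [E, hj, Ne.symm hj]
  have hE : (E k l : Mat N).conjTranspose = E l k := by simp [E]
  rw [hE, Ring.lie_def, Ring.lie_def, Matrix.add_apply, Matrix.sub_apply, Matrix.sub_apply,
    Matrix.mul_assoc (E i j), h1, h2, h3]
  ring

theorem lindblad_apply (H : Mat N) (Γ : Coeff N) (x : Mat N) (a b : Fin N) :
    lindblad H Γ x a b = -Complex.I * (H * x - x * H) a b +
      ∑ j, ∑ l, Γ (a, j) (b, l) * x j l -
      (1 / 2) * ∑ i, ∑ j, Γ (i, j) (i, a) * x j b -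
      (1 / 2) * ∑ i, ∑ l, Γ (i, b) (i, l) * x a l := by
  have h : lindblad H Γ x = -Complex.I • ⁅H, x⁆ + (1 / 2 : ℂ) • ∑ i, ∑ j, ∑ k, ∑ l,
    Γ (i, j) (k, l) •
      (⁅E i j, x * (E k l).conjTranspose⁆ + ⁅E i j * x, (E k l).conjTranspose⁆) := rfl
  rw [h, Matrix.add_apply, Matrix.smul_apply, Matrix.smul_apply, Ring.lie_def]
  simp only [Matrix.sum_apply, Matrix.smul_apply (_ : ℂ), dissipator_apply, smul_eq_mul, mul_sub,
    Finset.sum_sub_distrib, mul_ite, mul_zero, Finset.sum_ite_irrel, Finset.sum_const_zero,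
    Finset.sum_ite_eq', Finset.mem_univ, if_true]
  simp only [← mul_assoc, mul_comm _ (2 : ℂ)]
  simp only [mul_assoc, ← Finset.mul_sum]
  ring

variable {Γ : Coeff N} {h : Fin N → ℝ}

theorem hamiltonian_mul_apply (h : Fin N → ℝ) (x : Mat N) (a b : Fin N) :
    ((∑ n, (h n : ℂ) • E n n) * x - x * ∑ n, (h n : ℂ) • E n n) a b =
      ((h a : ℂ) - h b) * x a b := by
  have hd : (∑ n, (h n : ℂ) • E n n : Mat N) = Matrix.diagonal fun n => (h n : ℂ) := by
    ext i j
    simp only [E, Matrix.sum_apply, Matrix.smul_apply, Matrix.single_apply, Matrix.diagonal_apply,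
      smul_eq_mul]
    by_cases hij : i = j
    · subst hij; simp
    · rw [if_neg hij]
      refine Finset.sum_eq_zero fun n _ => ?_
      rw [if_neg, mul_zero]
      rintro ⟨rfl, rfl⟩
      exact hij rfl
  rw [hd, Matrix.sub_apply, Matrix.diagonal_mul, Matrix.mul_diagonal]
  ring

namespace IsPairBlockDiagonal

/-- Distinct pairs with the same first index are never swaps of each other when both are
off-diagonal. This makes the loss terms scalar and keeps diagonal entries fed by diagonal entries
only. -/
theorem apply_same_left (hpair : IsPairBlockDiagonal Γ) {i j a : Fin N} (hj : j ≠ a) :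
    Γ (i, j) (i, a) = 0 := by
  by_cases hij : i = j
  · subst hij
    exact hpair.diag_offDiag i a i hj
  · by_cases hia : i = a
    · subst hia
      exact hpair.offDiag_diag i j i hij
    · exact hpair.pairBlock i j i a hij hia (fun h => hj (Prod.mk.inj h).2.symm)
        (fun h => hij (Prod.mk.inj h).1)

theorem apply_diag_gain (hpair : IsPairBlockDiagonal Γ) {a b j l : Fin N} (hab : a ≠ b)
    (h1 : (j, l) ≠ (a, b)) (h2 : (j, l) ≠ (b, a)) : Γ (a, j) (b, l) = 0 := by
  by_cases hj : a = j
  · subst hj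
    have hbl : b ≠ l := fun h => h1 (by rw [h])
    exact hpair.diag_offDiag b l a hbl
  · by_cases hl : b = l
    · subst hl
      exact hpair.offDiag_diag a j b hj
    · refine hpair.pairBlock a j b l hj hl (fun h => hab (Prod.mk.inj h).1.symm) fun h => h2 ?_
      rw [(Prod.mk.inj h).1, (Prod.mk.inj h).2]

theorem sum_loss_left (hpair : IsPairBlockDiagonal Γ) (x : Mat N) (a b : Fin N) :
    ∑ i, ∑ j, Γ (i, j) (i, a) * x j b = (∑ i, Γ (i, a) (i, a)) * x a b := by
  rw [Finset.sum_mul]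
  refine Finset.sum_congr rfl fun i _ => Finset.sum_eq_single a (fun j _ hj => ?_) (by simp)
  rw [hpair.apply_same_left hj, zero_mul]

theorem sum_loss_right (hpair : IsPairBlockDiagonal Γ) (x : Mat N) (a b : Fin N) :
    ∑ i, ∑ l, Γ (i, b) (i, l) * x a l = (∑ i, Γ (i, b) (i, b)) * x a b := by
  rw [Finset.sum_mul]
  refine Finset.sum_congr rfl fun i _ => Finset.sum_eq_single b (fun j _ hj => ?_) (by simp)
  rw [hpair.apply_same_left (Ne.symm hj), zero_mul]

/-- The Hamiltonian part cancels on the diagonal and the two half loss terms add up, leaving a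
classical master equation. The self-loop terms `Γ (a, a) (a, a)` occur in both sums and cancel. -/
theorem lindblad_diag (hpair : IsPairBlockDiagonal Γ) (x : Mat N) (a : Fin N) :
    lindblad (∑ n, (h n : ℂ) • E n n) Γ x a a =
      ∑ j, Γ (a, j) (a, j) * x j j - ∑ j, Γ (j, a) (j, a) * x a a := by
  rw [lindblad_apply, hamiltonian_mul_apply, hpair.sum_loss_left, hpair.sum_loss_right,
    ← Finset.sum_mul]
  have : ∑ j, ∑ l, Γ (a, j) (a, l) * x j l = ∑ j, Γ (a, j) (a, j) * x j j := by
    refine Finset.sum_congr rfl fun j _ => Finset.sum_eq_single j (fun l _ hl => ?_) (by simp)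
    rw [hpair.apply_same_left (Ne.symm hl), zero_mul]
  rw [this]
  ring

end IsPairBlockDiagonal

/-- The coefficient of `x a b` in the `(a, b)` entry of the generator applied to `x`. -/
noncomputable def decoherence (h : Fin N → ℝ) (Γ : Coeff N) (a b : Fin N) : ℂ :=
  -Complex.I * ((h a : ℂ) - h b) + Γ (a, a) (b, b) -
    (1 / 2) * (∑ i, Γ (i, a) (i, a) + ∑ i, Γ (i, b) (i, b))

theorem IsPairBlockDiagonal.lindblad_offDiag (hpair : IsPairBlockDiagonal Γ) (x : Mat N)
    {a b : Fin N} (hab : a ≠ b) :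
    lindblad (∑ n, (h n : ℂ) • E n n) Γ x a b =
      decoherence h Γ a b * x a b + Γ (a, b) (b, a) * x b a := by
  rw [lindblad_apply, hamiltonian_mul_apply, hpair.sum_loss_left, hpair.sum_loss_right]
  have : ∑ j, ∑ l, Γ (a, j) (b, l) * x j l =
      Γ (a, a) (b, b) * x a b + Γ (a, b) (b, a) * x b a := by
    rw [← Fintype.sum_prod_type', ← Finset.sum_pair (f := fun p : Fin N × Fin N =>
      Γ (a, p.1) (b, p.2) * x p.1 p.2) (a := (a, b)) (b := (b, a))
      fun h => hab (Prod.mk.inj h).1]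
    symm
    refine Finset.sum_subset (Finset.subset_univ _) fun p _ hp => ?_
    simp only [Finset.mem_insert, Finset.mem_singleton, not_or] at hp
    rw [hpair.apply_diag_gain hab hp.1 hp.2, zero_mul]
  rw [this, decoherence]
  ring

end Entries

/-! ### Sinks -/

section Sinks

variable {V : Type} {w : V → V → ℝ}

theorem Reach.eq_or_exists_edge {i j : V} (h : Reach w i j) : i = j ∨ ∃ k, Edge w i k := by
  rcases Relation.ReflTransGen.cases_head h with h | ⟨k, hk, -⟩
  · exact Or.inl h
  · exact Or.inr ⟨k, hk⟩

theorem mem_of_reach_of_closed {S : Set V} (hS : ∀ i ∈ S, ∀ j, Edge w i j → j ∈ S) {i j : V}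
    (hi : i ∈ S) (hij : Reach w i j) : j ∈ S := by
  induction hij with
  | refl => exact hi
  | tail _ hbc ih => exact hS _ ih _ hbc

theorem isSink_iff (hw : ∀ i j, 0 ≤ w i j) {k : V} : IsSink w k ↔ ∀ j, j ≠ k → w j k = 0 := by
  constructor
  · intro h j hj
    exact h.weight_eq_zero hw rfl hj
  · intro h
    have hcl : ∀ j, Reach w k j → j = k := fun j hj =>
      mem_of_reach_of_closed (S := {k}) (by
        rintro i rfl j hE
        exact absurd (h j hE.1.symm) hE.2.ne') rfl hj
    have hs : scc w k = {k} := Set.eq_singleton_iff_unique_mem.2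
      ⟨mem_scc_self k, fun j hj => hcl j hj.1⟩
    rw [IsSink, ← hs]
    refine isTSCC_scc fun j hj => ?_
    rw [hcl j hj]
    exact Relation.ReflTransGen.refl

/-- This turns the graph condition into conditions on weights: the outflows from `k` and `l` to
third vertices vanish. -/
theorem isTwoSink_iff (hw : ∀ i j, 0 ≤ w i j) {k l : V} (hkl : k ≠ l) :
    IsTwoSink w k l ↔ 0 < w k l ∧ 0 < w l k ∧
      (∀ j, j ≠ k → j ≠ l → w j k = 0) ∧ ∀ j, j ≠ k → j ≠ l → w j l = 0 := by
  constructor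
  · rintro ⟨-, h⟩
    have hk : k ∈ ({k, l} : Set V) := by simp
    have hl : l ∈ ({k, l} : Set V) := by simp
    have hs := h.eq_scc hk
    have hlk : l ∈ scc w k := hs ▸ hl
    refine ⟨?_, ?_, fun j h1 h2 => h.weight_eq_zero hw hk (by simp [h1, h2]),
      fun j h1 h2 => h.weight_eq_zero hw hl (by simp [h1, h2])⟩
    · obtain h' | ⟨j, hj⟩ := Reach.eq_or_exists_edge hlk.2
      · exact absurd h'.symm hkl
      · rcases h.mem_of_reach hl (Relation.ReflTransGen.single hj) with rfl | h'
        · exact hj.2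
        · exact absurd h'.symm hj.1
    · obtain h' | ⟨j, hj⟩ := Reach.eq_or_exists_edge hlk.1
      · exact absurd h' hkl
      · rcases h.mem_of_reach hk (Relation.ReflTransGen.single hj) with h' | rfl
        · exact absurd h'.symm hj.1
        · exact hj.2
  · rintro ⟨h1, h2, h3, h4⟩
    have hEkl : Edge w k l := ⟨hkl, h2⟩
    have hElk : Edge w l k := ⟨hkl.symm, h1⟩
    have hcl : ∀ j, Reach w k j → j ∈ ({k, l} : Set V) := fun j hj =>
      mem_of_reach_of_closed (S := {k, l}) (by
        intro i hi j hE
        by_contra hj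
        simp only [Set.mem_insert_iff, Set.mem_singleton_iff, not_or] at hj
        rcases hi with rfl | rfl
        · exact hE.2.ne' (h3 j hj.1 hj.2)
        · exact hE.2.ne' (h4 j hj.1 hj.2)) (by simp) hj
    have hback : ∀ j, j ∈ ({k, l} : Set V) → Reach w j k := by
      rintro j (rfl | rfl)
      · exact Relation.ReflTransGen.refl
      · exact Relation.ReflTransGen.single hElk
    have hs : scc w k = {k, l} := by
      ext j
      refine ⟨fun hj => hcl j hj.1, fun hj => ⟨?_, hback j hj⟩⟩
      rcases hj with rfl | rfl
      · exact Relation.ReflTransGen.refl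
      · exact Relation.ReflTransGen.single hEkl
    refine ⟨hkl, ?_⟩
    rw [← hs]
    exact isTSCC_scc fun j hj => hback j (hcl j hj)

end Sinks

/-! ### The off-diagonal blocks -/

section Blocks

variable {N : ℕ}

theorem E_apply (i j a b : Fin N) : (E i j : Mat N) a b = if i = a ∧ j = b then 1 else 0 := rfl

theorem mem_pairSpace {k l : Fin N} (hkl : k ≠ l) {x : Mat N} :
    x ∈ pairSpace k l ↔ x = x k l • E k l + x l k • E l k := by
  rw [pairSpace, Submodule.mem_span_pair]
  constructor
  · rintro ⟨a, b, rfl⟩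
    simp [E_apply, hkl, hkl.symm]
  · intro h
    exact ⟨_, _, h.symm⟩

theorem pair_eq_zero_iff {k l : Fin N} (hkl : k ≠ l) {a b : ℂ} :
    a • (E k l : Mat N) + b • E l k = 0 ↔ a = 0 ∧ b = 0 := by
  constructor
  · intro h
    have h1 := congrFun (congrFun h k) l
    have h2 := congrFun (congrFun h l) k
    simp [E_apply, hkl, hkl.symm] at h1 h2
    exact ⟨h1, h2⟩
  · rintro ⟨rfl, rfl⟩
    simp

theorem mem_blockKer {k l : Fin N} (hkl : k ≠ l) {L : Mat N →ₗ[ℂ] Mat N} {x : Mat N} :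
    x ∈ blockKer L k l ↔ x ∈ pairSpace k l ∧ L x k l = 0 ∧ L x l k = 0 := by
  rw [blockKer, Submodule.mem_map]
  constructor
  · rintro ⟨y, hy, rfl⟩
    have := congrArg Subtype.val (LinearMap.mem_ker.1 hy)
    exact ⟨y.2, (pair_eq_zero_iff hkl).1 this⟩
  · rintro ⟨hx, h⟩
    exact ⟨⟨x, hx⟩, LinearMap.mem_ker.2 (Subtype.ext ((pair_eq_zero_iff hkl).2 h)), rfl⟩

instance (k l : Fin N) : FiniteDimensional ℂ (pairSpace k l) :=
  FiniteDimensional.span_of_finite ℂ (Set.toFinite _)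

theorem det_block_eq_zero_iff {L : Mat N →ₗ[ℂ] Mat N} {k l : Fin N} :
    LinearMap.det (block L k l) = 0 ↔ blockKer L k l ≠ ⊥ := by
  rw [LinearMap.det_eq_zero_iff_ker_ne_bot, blockKer, Ne, Ne, ← Submodule.map_bot
    (pairSpace k l).subtype,
    (Submodule.map_injective_of_injective (Submodule.subtype_injective _)).eq_iff]

end Blocks

/-! ### Positivity of the coefficients and the criterion for singular blocks -/

section Coefficients

/-- This is nonnegativity of the principal two by two minor on `p, q`. -/
theorem norm_sq_apply_le {ι : Type*} [Fintype ι] [DecidableEq ι] {M : Matrix ι ι ℂ}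
    (hM : M.PosSemidef) (p q : ι) : ‖M p q‖ ^ 2 ≤ (M p p).re * (M q q).re := by
  have h := (hM.submatrix ![p, q]).det_nonneg
  have hp : (M p p).im = 0 := (Complex.nonneg_iff.1 hM.diag_nonneg).2.symm
  have hq : (M q q).im = 0 := (Complex.nonneg_iff.1 hM.diag_nonneg).2.symm
  have hqp : M q p = star (M p q) := (hM.1.apply q p).symm
  rw [Matrix.det_fin_two] at h
  simp only [Matrix.submatrix_apply, Matrix.cons_val_zero, Matrix.cons_val_one, hqp] at h
  have h1 := (Complex.nonneg_iff.1 h).1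
  rw [← Complex.normSq_eq_norm_sq, Complex.normSq_apply]
  simp [Complex.sub_re, Complex.mul_re, hp, hq] at h1
  linarith

/-- Here `p` stands for `γ_{kkll}`, `z` for `γ_{kllk}`, and `Rk`, `Rl` for the outflows to third
vertices. The number `-Re c` is the sum of `(gkk + gll) / 2 - Re p ≥ 0`, `(gkl + glk) / 2 ≥ |z|` and
`(Rk + Rl) / 2 ≥ 0`, while `-Re c ≤ |c| = |z|`. Hence both arithmetic-geometric mean estimates are
equalities and the outflows vanish. -/
theorem extremal_coefficients {c z p : ℂ} {gkk gll gkl glk Rk Rl hk hl : ℝ} (hkk : 0 ≤ gkk)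
    (hll : 0 ≤ gll) (hkl : 0 ≤ gkl) (hlk : 0 ≤ glk) (hRk : 0 ≤ Rk) (hRl : 0 ≤ Rl)
    (hp : ‖p‖ ^ 2 ≤ gkk * gll) (hz : ‖z‖ ^ 2 ≤ gkl * glk)
    (hre : c.re = p.re - ((gkk + glk + Rk) + (gll + gkl + Rl)) / 2)
    (him : c.im = -(hk - hl) + p.im) (h : ‖c‖ = ‖z‖) :
    hk = hl ∧ p = gkk ∧ gkk = gll ∧ gkl = glk ∧ ‖z‖ = gkl ∧ Rk = 0 ∧ Rl = 0 := by
  have hpre : p.re ≤ (gkk + gll) / 2 := by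
    refine (Complex.re_le_norm p).trans (abs_le_of_sq_le_sq' ?_ (by linarith)).2
    nlinarith [sq_nonneg (gkk - gll)]
  have hzle : ‖z‖ ≤ (gkl + glk) / 2 := by
    refine (abs_le_of_sq_le_sq' ?_ (by linarith)).2
    nlinarith [sq_nonneg (gkl - glk)]
  have hcre : -c.re ≤ ‖z‖ := by
    rw [← h]
    exact (neg_le_abs _).trans (Complex.abs_re_le_norm c)
  have hRk0 : Rk = 0 := by linarith
  have hRl0 : Rl = 0 := by linarith
  have hp0 : p.re = (gkk + gll) / 2 := by linarith
  have hz0 : ‖z‖ = (gkl + glk) / 2 := by linarith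
  have hg : gkl = glk := by
    rw [hz0] at hz
    have : (gkl - glk) ^ 2 ≤ 0 := by nlinarith
    exact sub_eq_zero.1 (pow_eq_zero_iff two_ne_zero |>.1 (le_antisymm this (sq_nonneg _)))
  have hcn : ‖c‖ ^ 2 = c.re ^ 2 + c.im ^ 2 := by
    rw [← Complex.normSq_eq_norm_sq, Complex.normSq_apply]; ring
  have hpn : ‖p‖ ^ 2 = p.re ^ 2 + p.im ^ 2 := by
    rw [← Complex.normSq_eq_norm_sq, Complex.normSq_apply]; ring
  -- The real part already exhausts `|c|`. Once `p` is real as well, the imaginary part of `c` is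
  -- `-(hk - hl)`.
  have hcim : c.im = 0 := by
    have h1 : c.re = -‖z‖ := by linarith
    rw [h, h1] at hcn
    exact pow_eq_zero_iff two_ne_zero |>.1 (by linarith)
  rw [hpn, hp0] at hp
  have hpim : p.im = 0 :=
    pow_eq_zero_iff two_ne_zero |>.1
      (le_antisymm (by nlinarith [sq_nonneg (gkk - gll)]) (sq_nonneg _))
  have hgg : gkk = gll := by
    have : (gkk - gll) ^ 2 ≤ 0 := by nlinarith
    exact sub_eq_zero.1 (pow_eq_zero_iff two_ne_zero |>.1 (le_antisymm this (sq_nonneg _)))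
  refine ⟨by linarith, ?_, hgg, hg, by linarith, hRk0, hRl0⟩
  exact Complex.ext (by rw [hp0, Complex.ofReal_re]; linarith) (by rw [hpim, Complex.ofReal_im])

variable {N : ℕ} {Γ : Coeff N} {h : Fin N → ℝ}

theorem inducedWeight_nonneg (hΓ : Γ.PosSemidef) (i j : Fin N) : 0 ≤ inducedWeight Γ i j :=
  (Complex.nonneg_iff.1 hΓ.diag_nonneg).1

theorem coeff_diag (hΓ : Γ.PosSemidef) (i j : Fin N) :
    Γ (i, j) (i, j) = (inducedWeight Γ i j : ℂ) :=
  Complex.ext rfl (Complex.nonneg_iff.1 hΓ.diag_nonneg).2.symm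

theorem coeff_swap (hΓ : Γ.PosSemidef) (p q : Fin N × Fin N) : Γ q p = star (Γ p q) :=
  (hΓ.1.apply q p).symm

theorem sum_outflow (Γ : Coeff N) {k l : Fin N} (hkl : k ≠ l) :
    ∑ i, inducedWeight Γ i k = inducedWeight Γ k k + inducedWeight Γ l k +
      ∑ i ∈ (Finset.univ.erase k).erase l, inducedWeight Γ i k := by
  rw [← Finset.add_sum_erase _ _ (Finset.mem_univ k),
    ← Finset.add_sum_erase _ _ (Finset.mem_erase.2 ⟨hkl.symm, Finset.mem_univ l⟩), add_assoc]

theorem decoherence_eq (hΓ : Γ.PosSemidef) (k l : Fin N) :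
    decoherence h Γ k l = -Complex.I * ((h k : ℂ) - h l) + Γ (k, k) (l, l) -
      (((∑ i, inducedWeight Γ i k + ∑ i, inducedWeight Γ i l) / 2 : ℝ) : ℂ) := by
  simp only [decoherence, coeff_diag hΓ _ k, coeff_diag hΓ _ l]
  push_cast
  ring

theorem decoherence_swap (hΓ : Γ.PosSemidef) (k l : Fin N) :
    decoherence h Γ l k = star (decoherence h Γ k l) := by
  rw [decoherence_eq hΓ, decoherence_eq hΓ, coeff_swap hΓ (k, k) (l, l)]
  simp only [star_sub, star_add, star_mul', star_neg, Complex.star_def, Complex.conj_I,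
    Complex.conj_ofReal]
  push_cast
  ring

theorem mem_blockKer_lindblad (hpair : IsPairBlockDiagonal Γ) {k l : Fin N} (hkl : k ≠ l)
    {x : Mat N} :
    x ∈ blockKer (lindblad (∑ n, (h n : ℂ) • E n n) Γ) k l ↔ x ∈ pairSpace k l ∧
      decoherence h Γ k l * x k l + Γ (k, l) (l, k) * x l k = 0 ∧
      decoherence h Γ l k * x l k + Γ (l, k) (k, l) * x k l = 0 := by
  rw [mem_blockKer hkl, hpair.lindblad_offDiag x hkl, hpair.lindblad_offDiag x hkl.symm]

/-- Taking norms in the two kernel equations gives `|c| |x_kl| = |z| |x_lk|` and the same with the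
entries exchanged. Their sum can be divided by `|x_kl| + |x_lk| > 0`. -/
theorem norm_decoherence_eq (hΓ : Γ.PosSemidef) (hpair : IsPairBlockDiagonal Γ) {k l : Fin N}
    (hkl : k ≠ l) (hker : blockKer (lindblad (∑ n, (h n : ℂ) • E n n) Γ) k l ≠ ⊥) :
    ‖decoherence h Γ k l‖ = ‖Γ (k, l) (l, k)‖ := by
  obtain ⟨x, hx, hx0⟩ := Submodule.exists_mem_ne_zero_of_ne_bot hker
  obtain ⟨hxp, h1, h2⟩ := (mem_blockKer_lindblad hpair hkl).1 hx
  have h3 := congrArg norm (eq_neg_of_add_eq_zero_left h1)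
  have h4 := congrArg norm (eq_neg_of_add_eq_zero_left h2)
  rw [decoherence_swap hΓ, coeff_swap hΓ (k, l) (l, k)] at h4
  rw [norm_neg, norm_mul, norm_mul] at h3 h4
  rw [norm_star, norm_star] at h4
  have hpos : ‖x k l‖ + ‖x l k‖ ≠ 0 := by
    intro h0
    have ha : ‖x k l‖ = 0 := by linarith [norm_nonneg (x k l), norm_nonneg (x l k)]
    have hb : ‖x l k‖ = 0 := by linarith [norm_nonneg (x k l), norm_nonneg (x l k)]
    apply hx0
    rw [(mem_pairSpace hkl).1 hxp]
    exact (pair_eq_zero_iff hkl).2 ⟨norm_eq_zero.1 ha, norm_eq_zero.1 hb⟩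
  refine mul_right_cancel₀ hpos ?_
  linarith

/-- The condition characterizing singular `kl` blocks. -/
def SingularCondition (h : Fin N → ℝ) (Γ : Coeff N) (k l : Fin N) : Prop :=
  h k = h l ∧ Γ (k, k) (k, k) = Γ (l, l) (l, l) ∧ Γ (l, l) (l, l) = Γ (k, k) (l, l) ∧
    ((IsSink (inducedWeight Γ) k ∧ IsSink (inducedWeight Γ) l) ∨ IsSingularTwoSink Γ k l)

theorem isSingularTwoSink_det (hΓ : Γ.PosSemidef) {k l : Fin N} :
    (!![Γ (k, l) (k, l), Γ (k, l) (l, k); Γ (l, k) (k, l), Γ (l, k) (l, k)] :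
      Matrix (Fin 2) (Fin 2) ℂ).det = 0 ↔
    inducedWeight Γ k l * inducedWeight Γ l k = ‖Γ (k, l) (l, k)‖ ^ 2 := by
  rw [Matrix.det_fin_two_of, coeff_diag hΓ, coeff_diag hΓ, coeff_swap hΓ (k, l) (l, k),
    Complex.star_def, Complex.mul_conj, sub_eq_zero, Complex.normSq_eq_norm_sq]
  exact_mod_cast Iff.rfl

theorem singularCondition_of_blockKer_ne_bot (hΓ : Γ.PosSemidef) (hpair : IsPairBlockDiagonal Γ)
    {k l : Fin N} (hkl : k ≠ l)
    (hker : blockKer (lindblad (∑ n, (h n : ℂ) • E n n) Γ) k l ≠ ⊥) :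
    SingularCondition h Γ k l := by
  have hw := inducedWeight_nonneg hΓ
  obtain ⟨h1, h2, h3, h4, h5, h6, h7⟩ := extremal_coefficients (hw k k) (hw l l) (hw k l) (hw l k)
    (Finset.sum_nonneg fun i _ => hw i k) (Finset.sum_nonneg fun i _ => hw i l)
    (norm_sq_apply_le hΓ (k, k) (l, l)) (norm_sq_apply_le hΓ (k, l) (l, k))
    (c := decoherence h Γ k l) (hk := h k) (hl := h l)
    (Rk := ∑ i ∈ (Finset.univ.erase k).erase l, inducedWeight Γ i k)
    (Rl := ∑ i ∈ (Finset.univ.erase l).erase k, inducedWeight Γ i l)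
    (by
      rw [decoherence_eq hΓ, ← sum_outflow Γ hkl, ← sum_outflow Γ hkl.symm]
      simp)
    (by
      rw [decoherence_eq hΓ]
      simp)
    (norm_decoherence_eq hΓ hpair hkl hker)
  have hk0 := (Finset.sum_eq_zero_iff_of_nonneg fun i _ => hw i k).1 h6
  have hl0 := (Finset.sum_eq_zero_iff_of_nonneg fun i _ => hw i l).1 h7
  have hk1 : ∀ j, j ≠ k → j ≠ l → inducedWeight Γ j k = 0 := fun j hk hl =>
    hk0 j (by simp [hk, hl])
  have hl1 : ∀ j, j ≠ k → j ≠ l → inducedWeight Γ j l = 0 := fun j hk hl =>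
    hl0 j (by simp [hk, hl])
  refine ⟨h1, ?_, ?_, ?_⟩
  · rw [coeff_diag hΓ, coeff_diag hΓ, h3]
  · rw [coeff_diag hΓ, h2, h3]
  -- Only the common weight `γ_{kl} = γ_{lk}` can leave `k` or `l`: if it is zero both are sinks,
  -- otherwise they form a 2-sink.
  · rcases (hw k l).eq_or_lt with h0 | h0
    · refine Or.inl ⟨(isSink_iff hw).2 fun j hj => ?_, (isSink_iff hw).2 fun j hj => ?_⟩
      · by_cases hjl : j = l
        · rw [hjl, ← h4, ← h0]
        · exact hk1 j hj hjl
      · by_cases hjk : j = k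
        · rw [hjk, ← h0]
        · exact hl1 j hjk hj
    · refine Or.inr ⟨(isTwoSink_iff hw hkl).2 ⟨h0, h4 ▸ h0, hk1, hl1⟩, ?_, ?_⟩
      · rw [coeff_diag hΓ, coeff_diag hΓ, h4]
      · rw [isSingularTwoSink_det hΓ, h5, ← h4, sq]

/-- The Hamiltonian and dephasing terms cancel, and the only outflows left are those between `k` and
`l`. -/
theorem decoherence_of_singularCondition (hΓ : Γ.PosSemidef) {k l : Fin N} (hkl : k ≠ l)
    (hs : SingularCondition h Γ k l) :
    decoherence h Γ k l = (-(inducedWeight Γ k l + inducedWeight Γ l k) / 2 : ℝ) := by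
  have hw := inducedWeight_nonneg hΓ
  obtain ⟨h1, h2, h3, h4⟩ := hs
  have hout : (∀ j, j ≠ k → j ≠ l → inducedWeight Γ j k = 0) ∧
      ∀ j, j ≠ k → j ≠ l → inducedWeight Γ j l = 0 := by
    rcases h4 with ⟨hk, hl⟩ | hkl2
    · exact ⟨fun j hj _ => (isSink_iff hw).1 hk j hj, fun j _ hj => (isSink_iff hw).1 hl j hj⟩
    · exact ((isTwoSink_iff hw hkl).1 hkl2.1).2.2
  have hRk : ∑ i ∈ (Finset.univ.erase k).erase l, inducedWeight Γ i k = 0 :=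
    Finset.sum_eq_zero fun i hi => by
      simp only [Finset.mem_erase] at hi
      exact hout.1 i hi.2.1 hi.1
  have hRl : ∑ i ∈ (Finset.univ.erase l).erase k, inducedWeight Γ i l = 0 :=
    Finset.sum_eq_zero fun i hi => by
      simp only [Finset.mem_erase] at hi
      exact hout.2 i hi.1 hi.2.1
  have h5 : inducedWeight Γ k k = inducedWeight Γ l l := congrArg Complex.re h2
  rw [decoherence_eq hΓ, sum_outflow Γ hkl, sum_outflow Γ hkl.symm, hRk, hRl, ← h3,
    coeff_diag hΓ l l, h1, h5]
  push_cast
  ring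

theorem blockKer_of_isSink (hΓ : Γ.PosSemidef) (hpair : IsPairBlockDiagonal Γ)
    {k l : Fin N} (hkl : k ≠ l) (hs : SingularCondition h Γ k l)
    (hk : IsSink (inducedWeight Γ) k) (hl : IsSink (inducedWeight Γ) l) :
    blockKer (lindblad (∑ n, (h n : ℂ) • E n n) Γ) k l = Submodule.span ℂ {E k l, E l k} := by
  have hw := inducedWeight_nonneg hΓ
  have hkl0 := (isSink_iff hw).1 hl k hkl
  have hlk0 := (isSink_iff hw).1 hk l hkl.symm
  have hc : decoherence h Γ k l = 0 := by
    rw [decoherence_of_singularCondition hΓ hkl hs, hkl0, hlk0]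
    simp
  have hz : Γ (k, l) (l, k) = 0 := by
    have : ‖Γ (k, l) (l, k)‖ ^ 2 ≤ inducedWeight Γ k l * inducedWeight Γ l k :=
      norm_sq_apply_le hΓ (k, l) (l, k)
    rw [hkl0, zero_mul] at this
    exact norm_eq_zero.1 (pow_eq_zero_iff two_ne_zero |>.1 (le_antisymm this (sq_nonneg _)))
  ext x
  rw [mem_blockKer_lindblad hpair hkl, decoherence_swap hΓ k l, coeff_swap hΓ (k, l) (l, k), hc, hz]
  simp [pairSpace]

theorem mem_blockKer_of_isSingularTwoSink (hΓ : Γ.PosSemidef) (hpair : IsPairBlockDiagonal Γ)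
    {k l : Fin N} (hkl : k ≠ l) (hs : SingularCondition h Γ k l) (h2 : IsSingularTwoSink Γ k l)
    {x : Mat N} :
    x ∈ blockKer (lindblad (∑ n, (h n : ℂ) • E n n) Γ) k l ↔ x ∈ pairSpace k l ∧
      Γ (k, l) (k, l) * x k l = Γ (k, l) (l, k) * x l k ∧
      Γ (k, l) (k, l) * x l k = Γ (l, k) (k, l) * x k l := by
  have hg : inducedWeight Γ k l = inducedWeight Γ l k := congrArg Complex.re h2.2.1
  have hc : decoherence h Γ k l = -Γ (k, l) (k, l) := by
    rw [decoherence_of_singularCondition hΓ hkl hs, ← hg, coeff_diag hΓ]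
    push_cast
    ring
  have hc' : decoherence h Γ l k = -Γ (k, l) (k, l) := by
    rw [decoherence_swap hΓ, hc, coeff_diag hΓ]
    simp
  rw [mem_blockKer_lindblad hpair hkl, hc, hc']
  refine and_congr_right fun _ => and_congr ?_ ?_
  · rw [neg_mul, neg_add_eq_zero]
  · rw [neg_mul, neg_add_eq_zero]

theorem blockKer_of_isSingularTwoSink (hΓ : Γ.PosSemidef) (hpair : IsPairBlockDiagonal Γ)
    {k l : Fin N} (hkl : k ≠ l) (hs : SingularCondition h Γ k l) (h2 : IsSingularTwoSink Γ k l)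
    (hne : Γ (k, l) (l, k) ≠ -Γ (k, l) (k, l)) :
    blockKer (lindblad (∑ n, (h n : ℂ) • E n n) Γ) k l = Submodule.span ℂ
      {(Γ (k, l) (k, l) + Γ (k, l) (l, k)) • E k l +
        (Γ (k, l) (k, l) + Γ (l, k) (k, l)) • E l k} := by
  have hdet := h2.2.2
  rw [Matrix.det_fin_two_of, ← h2.2.1, sub_eq_zero] at hdet
  ext x
  rw [mem_blockKer_of_isSingularTwoSink hΓ hpair hkl hs h2, Submodule.mem_span_singleton]
  have hne' : Γ (k, l) (k, l) + Γ (k, l) (l, k) ≠ 0 := fun h0 => hne (by linear_combination h0)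
  constructor
  · rintro ⟨hx, h3, h4⟩
    refine ⟨x k l / (Γ (k, l) (k, l) + Γ (k, l) (l, k)), ?_⟩
    rw [smul_add, smul_smul, smul_smul, div_mul_cancel₀ _ hne']
    conv_rhs => rw [(mem_pairSpace hkl).1 hx]
    congr 2
    rw [div_mul_eq_mul_div, div_eq_iff hne']
    -- The difference of the two kernel equations is the proportionality between the coordinates of
    -- `x` and those of the spanning vector. Conversely, that vector satisfies each equation by the
    -- vanishing determinant.
    linear_combination h3 - h4
  · rintro ⟨c, rfl⟩
    refine ⟨?_, ?_, ?_⟩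
    · rw [pairSpace, Submodule.mem_span_pair]
      exact ⟨_, _, by rw [smul_add, smul_smul, smul_smul]⟩
    · simp [E_apply, hkl, hkl.symm]
      linear_combination c * hdet
    · simp [E_apply, hkl, hkl.symm]
      linear_combination c * hdet

theorem blockKer_of_isSingularTwoSink_of_eq_neg (hΓ : Γ.PosSemidef)
    (hpair : IsPairBlockDiagonal Γ) {k l : Fin N} (hkl : k ≠ l) (hs : SingularCondition h Γ k l)
    (h2 : IsSingularTwoSink Γ k l) (heq : Γ (k, l) (l, k) = -Γ (k, l) (k, l)) :
    blockKer (lindblad (∑ n, (h n : ℂ) • E n n) Γ) k l = Submodule.span ℂ {E k l - E l k} := by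
  have hw := inducedWeight_nonneg hΓ
  have hpos : Γ (k, l) (k, l) ≠ 0 := by
    rw [coeff_diag hΓ]
    exact_mod_cast ((isTwoSink_iff hw hkl).1 h2.1).1.ne'
  have heq' : Γ (l, k) (k, l) = -Γ (k, l) (k, l) := by
    rw [coeff_swap hΓ (k, l) (l, k), heq, coeff_diag hΓ]
    simp
  ext x
  rw [mem_blockKer_of_isSingularTwoSink hΓ hpair hkl hs h2, Submodule.mem_span_singleton, heq, heq']
  constructor
  · rintro ⟨hx, h3, -⟩
    refine ⟨x k l, ?_⟩
    have h5 : x l k = -x k l := by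
      refine mul_left_cancel₀ hpos ?_
      linear_combination h3
    conv_rhs => rw [(mem_pairSpace hkl).1 hx, h5]
    rw [smul_sub, neg_smul, sub_eq_add_neg]
  · rintro ⟨c, rfl⟩
    refine ⟨?_, ?_, ?_⟩
    · rw [pairSpace, Submodule.mem_span_pair]
      exact ⟨c, -c, by rw [smul_sub, neg_smul, sub_eq_add_neg]⟩
    · simp [E_apply, hkl, hkl.symm]
    · simp [E_apply, hkl, hkl.symm]

theorem blockKer_ne_bot_iff (hΓ : Γ.PosSemidef) (hpair : IsPairBlockDiagonal Γ)
    {k l : Fin N} (hkl : k ≠ l) :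
    blockKer (lindblad (∑ n, (h n : ℂ) • E n n) Γ) k l ≠ ⊥ ↔ SingularCondition h Γ k l := by
  refine ⟨singularCondition_of_blockKer_ne_bot hΓ hpair hkl, fun hs => ?_⟩
  rw [Submodule.ne_bot_iff]
  obtain ⟨hk, hl⟩ | h2 := hs.2.2.2
  · rw [blockKer_of_isSink hΓ hpair hkl hs hk hl]
    refine ⟨E k l, Submodule.subset_span (by simp), fun h0 => one_ne_zero (α := ℂ) ?_⟩
    exact ((pair_eq_zero_iff hkl (a := 1) (b := 0)).1 (by simpa using h0)).1
  · by_cases heq : Γ (k, l) (l, k) = -Γ (k, l) (k, l)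
    · rw [blockKer_of_isSingularTwoSink_of_eq_neg hΓ hpair hkl hs h2 heq]
      refine ⟨E k l - E l k, Submodule.mem_span_singleton_self _,
        fun h0 => one_ne_zero (α := ℂ) ?_⟩
      exact ((pair_eq_zero_iff hkl (a := 1) (b := -1)).1
        (by simpa [sub_eq_add_neg] using h0)).1
    · rw [blockKer_of_isSingularTwoSink hΓ hpair hkl hs h2 heq]
      refine ⟨_, Submodule.mem_span_singleton_self _, fun h0 => heq ?_⟩
      linear_combination ((pair_eq_zero_iff hkl).1 h0).1

end Coefficients

/-! ### Invariant elements of a semigroup -/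

section Semigroup

variable {N : ℕ} {T : ℝ → (Mat N →ₗ[ℂ] Mat N)} {L : Mat N →ₗ[ℂ] Mat N}

theorem IsGenerator.apply_eq_zero (hTL : IsGenerator T L) {ρ : Mat N}
    (hρ : ∀ t : ℝ, 0 ≤ t → T t ρ = ρ) : L ρ = 0 := by
  refine tendsto_nhds_unique (hTL ρ) (tendsto_const_nhds.congr' ?_)
  filter_upwards [self_mem_nhdsWithin] with t ht
  rw [hρ t (le_of_lt ht), sub_self, smul_zero]

theorem IsQDS.apply_eq_self (hT : IsQDS T) (hTL : IsGenerator T L) {ρ : Mat N} (hρ : L ρ = 0)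
    {t : ℝ} (ht : 0 ≤ t) : T t ρ = ρ := by
  ext a b
  have hcont : ContinuousOn (fun s => T s ρ a b) (Set.Icc 0 t) := by
    have h1 := (hT.continuousOn ρ).mono (Set.Icc_subset_Ici_self (a := t) (b := (0 : ℝ)))
    exact (continuous_apply_apply a b).comp_continuousOn h1
  have hderiv : ∀ s ∈ Set.Ico 0 t,
      HasDerivWithinAt (fun s => T s ρ a b) 0 (Set.Ici s) s := by
    intro s hs
    rw [← hasDerivWithinAt_Ioi_iff_Ici, hasDerivWithinAt_iff_tendsto_slope' (by simp)]
    -- By the semigroup law the right difference quotient at `s` is `T s` applied to the one at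
    -- zero, so it tends to `T s (L ρ) = 0`.
    have h1 : Filter.Tendsto (fun r : ℝ => T s (((r : ℂ)⁻¹) • (T r ρ - ρ)) a b) (𝓝[>] 0) (𝓝 0) := by
      have hc : Continuous fun x : Mat N => T s x a b :=
        (continuous_apply_apply a b).comp (LinearMap.continuous_of_finiteDimensional (T s))
      have := (hc.tendsto (L ρ)).comp (hTL ρ)
      simpa [hρ, Function.comp_def] using this
    have h2 : Filter.Tendsto (fun u : ℝ => u - s) (𝓝[>] s) (𝓝[>] 0) := by
      refine tendsto_nhdsWithin_iff.2 ⟨?_, ?_⟩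
      · have : Filter.Tendsto (fun u : ℝ => u - s) (𝓝 s) (𝓝 (s - s)) :=
          (continuous_id.sub continuous_const).tendsto s
        rw [sub_self] at this
        exact this.mono_left nhdsWithin_le_nhds
      · filter_upwards [self_mem_nhdsWithin] with u hu
        exact sub_pos.2 (Set.mem_Ioi.1 hu)
    refine (h1.comp h2).congr' ?_
    filter_upwards [self_mem_nhdsWithin] with u hu
    have hu0 : 0 ≤ u - s := (sub_pos.2 (Set.mem_Ioi.1 hu)).le
    have hadd := congrArg (fun F : Mat N →ₗ[ℂ] Mat N => F ρ) (hT.add s (u - s) hs.1 hu0)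
    simp only [add_sub_cancel, LinearMap.comp_apply] at hadd
    simp only [Function.comp_apply, map_smul, map_sub, slope, vsub_eq_sub, Matrix.smul_apply,
      Matrix.sub_apply, smul_eq_mul, hadd, Complex.real_smul]
    push_cast
    rfl
  have := constant_of_has_deriv_right_zero hcont hderiv t ⟨ht, le_rfl⟩
  simpa [hT.zero] using this

end Semigroup

/-! ### The direct sum decomposition of the kernel -/

section Kernel

variable {N : ℕ} {Γ : Coeff N} {h : Fin N → ℝ}

/-- The summand containing the standard basis matrix with the given index. -/
def entryClass (a b : Fin N) : Option {p : Fin N × Fin N // p.1 < p.2} :=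
  if h : a < b then some ⟨(a, b), h⟩ else if h : b < a then some ⟨(b, a), h⟩ else none

theorem entryClass_eq_some {a b : Fin N} {p : {p : Fin N × Fin N // p.1 < p.2}} :
    entryClass a b = some p ↔ (a, b) = p.1 ∨ (b, a) = p.1 := by
  obtain ⟨⟨k, l⟩, hkl⟩ := p
  change k < l at hkl
  unfold entryClass
  split_ifs with h1 h2
  · simp only [Option.some_inj, Subtype.mk.injEq, Prod.mk.injEq]
    exact ⟨Or.inl, fun h => h.resolve_right fun h' => by
      rw [h'.1, h'.2] at h1; exact lt_asymm h1 hkl⟩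
  · simp only [Option.some_inj, Subtype.mk.injEq, Prod.mk.injEq]
    exact ⟨Or.inr, fun h => h.resolve_left fun h' => h1 (by rw [h'.1, h'.2]; exact hkl)⟩
  · simp only [Prod.mk.injEq, false_iff, not_or]
    exact ⟨fun h' => h1 (by rw [h'.1, h'.2]; exact hkl),
      fun h' => h2 (by rw [h'.1, h'.2]; exact hkl)⟩

theorem entryClass_eq_none {a b : Fin N} : entryClass a b = none ↔ a = b := by
  unfold entryClass
  split_ifs with h1 h2
  · simp [h1.ne]
  · simp [h2.ne']
  · simpa using le_antisymm (not_lt.1 h2) (not_lt.1 h1)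

/-- The matrices supported on the entries satisfying `P`. -/
def supportedOn (P : Fin N → Fin N → Prop) : Submodule ℂ (Mat N) where
  carrier := {x | ∀ a b, ¬ P a b → x a b = 0}
  zero_mem' := fun _ _ _ => rfl
  add_mem' := fun hx hy a b hP => by rw [Matrix.add_apply, hx a b hP, hy a b hP, add_zero]
  smul_mem' := fun c x hx a b hP => by rw [Matrix.smul_apply, hx a b hP, smul_zero]

theorem dMat_eq_diagonal (w : Fin N → Fin N → ℝ) (C : Set (Fin N)) :
    dMat w C = Matrix.diagonal fun i => (rho w C i : ℂ) := by
  ext a b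
  simp only [dMat, Matrix.sum_apply, Matrix.smul_apply, E_apply, smul_eq_mul, mul_ite, mul_one,
    mul_zero, Matrix.diagonal_apply, ite_and, Finset.sum_ite_eq', Finset.mem_univ, if_true]

theorem span_dMat (w : Fin N → Fin N → ℝ) (hw : ∀ i j, 0 ≤ w i j) :
    Submodule.span ℂ (dMat w '' {C | IsTSCC w C}) =
      (stationary w).map (Matrix.diagonalLinearMap (Fin N) ℂ ℂ) := by
  rw [stationary_eq_span hw, Submodule.map_span, Set.image_image]
  congr 1
  refine Set.image_congr fun C _ => ?_
  rw [dMat_eq_diagonal]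
  rfl

theorem apply_eq_zero_of_mem_kerSummand (hΓ : Γ.PosSemidef) {L : Mat N →ₗ[ℂ] Mat N}
    {s : Option {p : Fin N × Fin N // p.1 < p.2}} {x : Mat N} (hx : x ∈ kerSummand L Γ s)
    {a b : Fin N} (hab : entryClass a b ≠ s) : x a b = 0 := by
  match s with
  | some ⟨(k, l), hkl⟩ =>
    have hx' := ((mem_blockKer (ne_of_lt hkl)).1 hx).1
    rw [Ne, entryClass_eq_some, not_or] at hab
    rw [(mem_pairSpace (ne_of_lt hkl)).1 hx']
    simp only [Prod.mk.injEq] at hab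
    have h1 : ¬ (k = a ∧ l = b) := fun h => hab.1 ⟨h.1.symm, h.2.symm⟩
    have h2 : ¬ (l = a ∧ k = b) := fun h => hab.2 ⟨h.2.symm, h.1.symm⟩
    simp [E_apply, h1, h2]
  | none =>
    rw [kerSummand, span_dMat _ (inducedWeight_nonneg hΓ)] at hx
    obtain ⟨y, -, rfl⟩ := hx
    rw [Ne, entryClass_eq_none] at hab
    exact Matrix.diagonal_apply_ne _ hab

/-- The summands are supported on disjoint sets of matrix entries, namely the fibres of
`entryClass`. -/
theorem iSupIndep_kerSummand (hΓ : Γ.PosSemidef) (L : Mat N →ₗ[ℂ] Mat N) :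
    iSupIndep (kerSummand L Γ) := by
  rw [iSupIndep_def]
  intro s
  rw [Submodule.disjoint_def]
  intro x hx hx'
  have hle : ⨆ t, ⨆ (_ : t ≠ s), kerSummand L Γ t ≤ supportedOn fun a b => entryClass a b ≠ s := by
    refine iSup₂_le fun t ht y hy a b hab => ?_
    exact apply_eq_zero_of_mem_kerSummand hΓ hy fun h => hab fun h' => ht (h.symm.trans h')
  ext a b
  by_cases hab : entryClass a b = s
  · exact hle hx' a b (not_not.2 hab)
  · exact apply_eq_zero_of_mem_kerSummand hΓ hx hab

/-- The entries of `L x` in a class depend only on the entries of `x` in that class, so membership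
in the kernel can be tested class by class. -/
theorem ker_lindblad (hΓ : Γ.PosSemidef) (hpair : IsPairBlockDiagonal Γ) :
    LinearMap.ker (lindblad (∑ n, (h n : ℂ) • E n n) Γ) =
      ⨆ s, kerSummand (lindblad (∑ n, (h n : ℂ) • E n n) Γ) Γ s := by
  set L := lindblad (∑ n, (h n : ℂ) • E n n) Γ with hL
  have hw := inducedWeight_nonneg hΓ
  have hdiag : ∀ (x : Mat N), (∀ a, L x a a = 0) ↔
      (fun i => x i i) ∈ stationary (inducedWeight Γ) := by
    intro x
    rw [mem_stationary]
    refine forall_congr' fun a => ?_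
    rw [hL, hpair.lindblad_diag, sub_eq_zero]
    simp only [coeff_diag hΓ]
  apply le_antisymm
  · intro x hx
    have hLx : ∀ a b, L x a b = 0 := fun a b => by
      rw [LinearMap.mem_ker.1 hx, Matrix.zero_apply]
    -- The truncation of `x` to the entries of class `s`.
    let P : Option {p : Fin N × Fin N // p.1 < p.2} → Mat N := fun s =>
      Matrix.of fun a b => if entryClass a b = s then x a b else 0
    have hsum : x = ∑ s, P s := by
      ext a b
      rw [Matrix.sum_apply]
      simp [P]
    rw [hsum]
    refine Submodule.sum_mem _ fun s _ => Submodule.mem_iSup_of_mem s ?_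
    match s with
    | some ⟨(k, l), hkl⟩ =>
      have hne : k ≠ l := ne_of_lt hkl
      have h1 : P (some ⟨(k, l), hkl⟩) k l = x k l := by
        simp [P, entryClass_eq_some]
      have h2 : P (some ⟨(k, l), hkl⟩) l k = x l k := by
        simp [P, entryClass_eq_some]
      refine (mem_blockKer hne).2 ⟨?_, ?_, ?_⟩
      · rw [mem_pairSpace hne, h1, h2]
        ext a b
        simp only [P, Matrix.of_apply, entryClass_eq_some, Matrix.add_apply, Matrix.smul_apply,
          E_apply, smul_eq_mul, Prod.mk.injEq]
        by_cases h3 : a = k ∧ b = l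
        · obtain ⟨rfl, rfl⟩ := h3
          simp [hne, hne.symm]
        · by_cases h4 : a = l ∧ b = k
          · obtain ⟨rfl, rfl⟩ := h4
            simp [hne, hne.symm]
          · rw [if_neg, if_neg, if_neg]
            · simp
            · exact fun h => h4 ⟨h.1.symm, h.2.symm⟩
            · exact fun h => h3 ⟨h.1.symm, h.2.symm⟩
            · exact not_or.2 ⟨h3, fun h => h4 ⟨h.2, h.1⟩⟩
      · rw [← hLx k l, hL, hpair.lindblad_offDiag _ hne, hpair.lindblad_offDiag _ hne, h1, h2]
      · rw [← hLx l k, hL, hpair.lindblad_offDiag _ hne.symm, hpair.lindblad_offDiag _ hne.symm,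
          h1, h2]
    | none =>
      rw [kerSummand, span_dMat _ hw]
      refine ⟨fun i => x i i, (hdiag x).1 fun a => hLx a a, ?_⟩
      ext a b
      simp only [P, Matrix.of_apply, entryClass_eq_none]
      by_cases hab : a = b
      · subst hab
        rw [if_pos rfl]
        exact Matrix.diagonal_apply_eq _ _
      · rw [if_neg hab]
        exact Matrix.diagonal_apply_ne _ hab
  · refine iSup_le fun s x hx => LinearMap.mem_ker.2 ?_
    have hsupp : ∀ a b, entryClass a b ≠ s → x a b = 0 := fun a b hab =>
      apply_eq_zero_of_mem_kerSummand hΓ hx hab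
    match s with
    | some ⟨(k, l), hkl⟩ =>
      have hne : k ≠ l := ne_of_lt hkl
      obtain ⟨-, h1, h2⟩ := (mem_blockKer hne).1 hx
      ext a b
      by_cases hab : a = b
      · subst hab
        refine (hdiag x).2 ?_ a
        have : (fun i => x i i) = 0 := by
          funext i
          refine hsupp i i ?_
          rw [entryClass_eq_none.2 rfl]
          simp
        rw [this]
        exact zero_mem _
      · by_cases hc : entryClass a b = some ⟨(k, l), hkl⟩
        · rcases entryClass_eq_some.1 hc with h | h <;> obtain ⟨rfl, rfl⟩ := Prod.mk.inj h
          · exact h1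
          · exact h2
        · have hc' : entryClass b a ≠ some ⟨(k, l), hkl⟩ := by
            rw [Ne, entryClass_eq_some, or_comm, ← entryClass_eq_some]
            exact hc
          rw [hL, hpair.lindblad_offDiag _ hab, hsupp a b hc, hsupp b a hc']
          simp
    | none =>
      ext a b
      by_cases hab : a = b
      · subst hab
        refine (hdiag x).2 ?_ a
        rw [kerSummand, span_dMat _ hw] at hx
        obtain ⟨y, hy, rfl⟩ := hx
        simpa [Matrix.diagonalLinearMap] using hy
      · rw [hL, hpair.lindblad_offDiag _ hab,
          hsupp a b (fun h => hab (entryClass_eq_none.1 h)),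
          hsupp b a (fun h => hab (entryClass_eq_none.1 h).symm)]
        simp

end Kernel

end PairBlockQDS

theorem theorem6p1 (N : ℕ) (h : Fin N → ℝ) (Γ : Coeff N)
    (hΓ : Γ.PosSemidef) (hpair : IsPairBlockDiagonal Γ)
    (L : Mat N →ₗ[ℂ] Mat N)
    (hL : L = lindblad (∑ n, (h n : ℂ) • E n n) Γ) :
    -- the kernel is the (internal) direct sum of the summands
    (iSupIndep (kerSummand L Γ) ∧ LinearMap.ker L = ⨆ s, kerSummand L Γ s) ∧
    -- the normalization factors in the definition of the matrices `d^C` are positive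
    (∀ C : Set (Fin N), IsTSCC (inducedWeight Γ) C → 0 < normFactor (inducedWeight Γ) C) ∧
    -- description of the kernels of the off-diagonal blocks
    (∀ k l : Fin N, k < l →
      (LinearMap.det (block L k l) = 0 ↔
        h k = h l ∧ Γ (k, k) (k, k) = Γ (l, l) (l, l) ∧ Γ (l, l) (l, l) = Γ (k, k) (l, l) ∧
          ((IsSink (inducedWeight Γ) k ∧ IsSink (inducedWeight Γ) l) ∨
            IsSingularTwoSink Γ k l)) ∧
      (LinearMap.det (block L k l) = 0 →
        (IsSink (inducedWeight Γ) k ∧ IsSink (inducedWeight Γ) l →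
          blockKer L k l = Submodule.span ℂ {E k l, E l k}) ∧
        (IsSingularTwoSink Γ k l → Γ (k, l) (l, k) ≠ -Γ (k, l) (k, l) →
          blockKer L k l = Submodule.span ℂ
            {(Γ (k, l) (k, l) + Γ (k, l) (l, k)) • E k l +
              (Γ (k, l) (k, l) + Γ (l, k) (k, l)) • E l k}) ∧
        (IsSingularTwoSink Γ k l → Γ (k, l) (l, k) = -Γ (k, l) (k, l) →
          blockKer L k l = Submodule.span ℂ {E k l - E l k}))) ∧
    -- the invariant states of the semigroup generated by `L` are the states in the direct sum
    (∀ T : ℝ → (Mat N →ₗ[ℂ] Mat N), IsQDS T → IsGenerator T L →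
      ∀ ρ : Mat N, IsState ρ →
        ((∀ t : ℝ, 0 ≤ t → T t ρ = ρ) ↔ ρ ∈ ⨆ s, kerSummand L Γ s)) := by
  subst hL
  have hker := ker_lindblad (h := h) hΓ hpair
  refine ⟨⟨iSupIndep_kerSummand hΓ _, hker⟩, fun C hC => normFactor_pos hC, fun k l hkl => ?_,
    fun T hT hTL ρ _ => ?_⟩
  · have hne : k ≠ l := ne_of_lt hkl
    have hiff : LinearMap.det (block (lindblad (∑ n, (h n : ℂ) • E n n) Γ) k l) = 0 ↔
        SingularCondition h Γ k l :=
      det_block_eq_zero_iff.trans (blockKer_ne_bot_iff hΓ hpair hne)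
    refine ⟨hiff, fun hdet => ?_⟩
    have hs := hiff.1 hdet
    exact ⟨fun hsink => blockKer_of_isSink hΓ hpair hne hs hsink.1 hsink.2,
      fun h2 => blockKer_of_isSingularTwoSink hΓ hpair hne hs h2,
      fun h2 => blockKer_of_isSingularTwoSink_of_eq_neg hΓ hpair hne hs h2⟩
  · rw [← hker, LinearMap.mem_ker]
    exact ⟨hTL.apply_eq_zero, fun hρ t ht => hT.apply_eq_self hTL hρ ht⟩
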